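/- All C*-algebras are over $\mathbb{C}$; subalgebras are C*-subalgebras, and a unital subalgebra of $A$ contains the identity of $A$. A unital C*-algebra $A$ is finite if $v^* v = 1$ implies $v v^* = 1$ for $v \in A$, and stably finite if $M_n(A)$ is finite for all $n \geq 1$. For a C*-algebra $D$ and $a, b \in D_+$, write $a \preccurlyeq_D b$ if there is a sequence $(v_n)$ in $D$ with $\lim_{n \to \infty} v_n b v_n^* = a$. Let $A$ be an infinite dimensional simple unital C*-algebra. A unital subalgebra $B \subset A$ is centrally large in $A$ if for every $m \in \mathbb{Z}_{>0}$, $a_1, \ldots, a_m \in A$, $\varepsilon > 0$, $x \in A_+$ with $\|x\| = 1$, and $y \in B_+ \setminus \{0\}$, there are $c_1, \ldots, c_m \in A$ and $g \in B$ such that: (1) $0 \leq g \leq 1$; (2) $\|c_j - a_j\| < \varepsilon$ for all $j$; (3) $(1-g) c_j \in B$ for all $j$; (4) $g \preccurlyeq_B y$ and $g \preccurlyeq_A x$; (5) $\|(1-g) x (1-g)\| > 1 - \varepsilon$; (6) $\|g a_j - a_j g\| < \varepsilon$ for all $j$. It is stably centrally large in $A$ if $M_n(B)$ is centrally large in $M_n(A)$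 for all $n \geq 1$. **Proposition 3.5.** Let $A_1$ and $A_2$ be infinite dimensional simple unital C*-algebras, and let $B_1 \subset A_1$ and $B_2 \subset A_2$ be centrally large subalgebras. Assume that $A_1 \otimes_{\min} A_2$ is finite. Then $A_1 \otimes_{\min} A_2$ is infinite dimensional and simple, and $B_1 \otimes_{\min} B_2$ is a centrally large subalgebra of it. Here, for any faithful unital representations $\pi_i \colon A_i \to L(H_i)$ on Hilbert spaces, $A_1 \otimes_{\min} A_2$ is the C*-algebra of operators on the Hilbert space tensor product $H_1 \otimes H_2$ generated by the operators $\pi_1(a_1) \otimes \pi_2(a_2)$ with $a_i \in A_i$, and $B_1 \otimes_{\min} B_2$ is its C*-subalgebra generated by those with $a_i \in B_i$. **Corollary 3.6.** Let $A$ be a stably finite infinite dimensional simple unital C*-algebra, and let $B \subset A$ be a centrally large subalgebra. Then $B$ is stably centrally large in $A$. -/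

import Mathlib

open scoped TensorProduct
open Filter Topology

/-! ### Simplicity and finiteness -/

/-- A C*-algebra is simple if it is nonzero and its only closed two-sided ideals are `0` and the
whole algebra. -/
def IsSimpleCStar (A : Type*) [CStarAlgebra A] : Prop :=
  Nontrivial A ∧ ∀ I : TwoSidedIdeal A, IsClosed (I : Set A) → I = ⊥ ∨ I = ⊤

/-- A unital C*-algebra is finite if every isometry in it is a unitary. -/
def IsFiniteCStar (A : Type*) [CStarAlgebra A] : Prop :=
  ∀ v : A, star v * v = 1 → v * star v = 1

/-! ### Cuntz comparison and centrally large subalgebras -/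

/-- Cuntz subequivalence `a ≼ b` relative to the C*-algebra `D`, for elements `a b` of `D`:
there is a sequence `vₙ` in `D` with `vₙ b vₙ* → a`. -/
def CuntzSubequiv {D : Type*} [Mul D] [Star D] [TopologicalSpace D] (a b : D) : Prop :=
  ∃ v : ℕ → D, Tendsto (fun n => v n * b * star (v n)) atTop (𝓝 a)

section Large

/- Every C*-algebra carries its usual order: `a ≤ b` if and only if `b - a` is self-adjoint with
spectrum in `[0, ∞)`. -/
attribute [local instance] CStarAlgebra.spectralOrder CStarAlgebra.spectralOrderedRing

/-- `B` is a centrally large (unital C*-)subalgebra of `A`. The notion is only meaningful for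
infinite dimensional simple unital C*-algebras `A`, and this is part of the definition. -/
structure IsCentrallyLarge {A : Type*} [CStarAlgebra A] (B : StarSubalgebra ℂ A) : Prop where
  infinite : ¬ FiniteDimensional ℂ A
  simple : IsSimpleCStar A
  closed : IsClosed (B : Set A)
  cut : ∀ (m : ℕ), 0 < m → ∀ (a : Fin m → A) (ε : ℝ), 0 < ε →
    ∀ x : A, 0 ≤ x → ‖x‖ = 1 → ∀ y : B, 0 ≤ (y : A) → y ≠ 0 →
    ∃ (c : Fin m → A) (g : B),
      (0 ≤ (g : A) ∧ (g : A) ≤ 1) ∧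
      (∀ j, ‖c j - a j‖ < ε) ∧
      (∀ j, (1 - (g : A)) * c j ∈ B) ∧
      (CuntzSubequiv g y ∧ CuntzSubequiv (g : A) x) ∧
      1 - ε < ‖(1 - (g : A)) * x * (1 - (g : A))‖ ∧
      (∀ j, ‖(g : A) * a j - a j * (g : A)‖ < ε)

/-- The C*-algebra `M_n(A)` of `n × n` matrices over `A` is finite for all `n`. -/
def IsStablyFiniteCStar (A : Type*) [CStarAlgebra A] : Prop :=
  ∀ n : ℕ, 0 < n → IsFiniteCStar (CStarMatrix (Fin n) (Fin n) A)

/-- The subalgebra `M_n(B)` of `M_n(A)`: matrices all of whose entries are in `B`. -/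
def matrixSubalgebra {A : Type*} [CStarAlgebra A] (n : ℕ) (B : StarSubalgebra ℂ A) :
    StarSubalgebra ℂ (CStarMatrix (Fin n) (Fin n) A) where
  carrier := {M | ∀ i j, M i j ∈ B}
  mul_mem' {M N} hM hN i j := by
    rw [CStarMatrix.mul_apply]
    exact sum_mem fun k _ => mul_mem (hM i k) (hN k j)
  add_mem' {M N} hM hN i j := add_mem (hM i j) (hN i j)
  algebraMap_mem' r i j := by
    rw [Algebra.algebraMap_eq_smul_one, CStarMatrix.smul_apply, CStarMatrix.one_apply]
    split_ifs
    · exact SMulMemClass.smul_mem r (one_mem B)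
    · exact SMulMemClass.smul_mem r (zero_mem B)
  star_mem' {M} hM i j := by
    rw [CStarMatrix.star_apply]
    exact star_mem (hM j i)

/-- `M_n(B)` is centrally large in `M_n(A)` for all `n ≥ 1`. -/
def IsStablyCentrallyLarge {A : Type*} [CStarAlgebra A] (B : StarSubalgebra ℂ A) : Prop :=
  ∀ n : ℕ, 0 < n → IsCentrallyLarge (matrixSubalgebra n B)

end Large

/-! ### The minimal (spatial) tensor product -/

/-- The Hilbert space tensor product: the completion of the algebraic tensor product for the inner
product with `⟪x₁ ⊗ y₁, x₂ ⊗ y₂⟫ = ⟪x₁, x₂⟫ ⟪y₁, y₂⟫`. -/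
def HilbertTensor (H₁ H₂ : Type*) [NormedAddCommGroup H₁] [InnerProductSpace ℂ H₁]
    [NormedAddCommGroup H₂] [InnerProductSpace ℂ H₂] : Type _ :=
  UniformSpace.Completion (H₁ ⊗[ℂ] H₂)

section HilbertTensor

variable (H₁ H₂ : Type*) [NormedAddCommGroup H₁] [InnerProductSpace ℂ H₁]
  [NormedAddCommGroup H₂] [InnerProductSpace ℂ H₂]

noncomputable instance : NormedAddCommGroup (HilbertTensor H₁ H₂) :=
  inferInstanceAs (NormedAddCommGroup (UniformSpace.Completion (H₁ ⊗[ℂ] H₂)))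

noncomputable instance : InnerProductSpace ℂ (HilbertTensor H₁ H₂) :=
  inferInstanceAs (InnerProductSpace ℂ (UniformSpace.Completion (H₁ ⊗[ℂ] H₂)))

instance : CompleteSpace (HilbertTensor H₁ H₂) :=
  inferInstanceAs (CompleteSpace (UniformSpace.Completion (H₁ ⊗[ℂ] H₂)))

end HilbertTensor

section Spatial

variable {H₁ H₂ : Type*} [NormedAddCommGroup H₁] [InnerProductSpace ℂ H₁] [CompleteSpace H₁]
  [NormedAddCommGroup H₂] [InnerProductSpace ℂ H₂] [CompleteSpace H₂]
  {A₁ A₂ : Type*} [CStarAlgebra A₁] [CStarAlgebra A₂]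

/-- The operator `S ⊗ T` on the Hilbert space tensor product, determined by
`(S ⊗ T) (x ⊗ y) = S x ⊗ T y`. -/
noncomputable def tensorOp (S : H₁ →L[ℂ] H₁) (T : H₂ →L[ℂ] H₂) :
    HilbertTensor H₁ H₂ →L[ℂ] HilbertTensor H₁ H₂ :=
  ((TensorProduct.mapL S T).completion :
    UniformSpace.Completion (H₁ ⊗[ℂ] H₂) →L[ℂ] UniformSpace.Completion (H₁ ⊗[ℂ] H₂))

/-- For faithful representations `π₁` of `A₁` on `H₁` and `π₂` of `A₂` on `H₂`, the minimal tensor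
product `A₁ ⊗_min A₂`: the C*-algebra of operators on the Hilbert space tensor product which is
generated by all `π₁ a₁ ⊗ π₂ a₂`. -/
noncomputable def minTensor (π₁ : A₁ →⋆ₐ[ℂ] (H₁ →L[ℂ] H₁)) (π₂ : A₂ →⋆ₐ[ℂ] (H₂ →L[ℂ] H₂)) :
    StarSubalgebra ℂ (HilbertTensor H₁ H₂ →L[ℂ] HilbertTensor H₁ H₂) :=
  (StarAlgebra.adjoin ℂ
    {T | ∃ (a₁ : A₁) (a₂ : A₂), T = tensorOp (π₁ a₁) (π₂ a₂)}).topologicalClosure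

noncomputable instance (π₁ : A₁ →⋆ₐ[ℂ] (H₁ →L[ℂ] H₁)) (π₂ : A₂ →⋆ₐ[ℂ] (H₂ →L[ℂ] H₂)) :
    CStarAlgebra (minTensor π₁ π₂) :=
  StarSubalgebra.cstarAlgebra _ (h_closed := StarSubalgebra.isClosed_topologicalClosure _)

/-- The elementary tensor `a₁ ⊗ a₂` in `A₁ ⊗_min A₂`. -/
noncomputable def minTmul (π₁ : A₁ →⋆ₐ[ℂ] (H₁ →L[ℂ] H₁)) (π₂ : A₂ →⋆ₐ[ℂ] (H₂ →L[ℂ] H₂))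
    (a₁ : A₁) (a₂ : A₂) : minTensor π₁ π₂ :=
  ⟨tensorOp (π₁ a₁) (π₂ a₂), StarSubalgebra.le_topologicalClosure _
    (StarAlgebra.subset_adjoin ℂ _ ⟨a₁, a₂, rfl⟩)⟩

/-- For subalgebras `B₁` of `A₁` and `B₂` of `A₂`, the minimal tensor product `B₁ ⊗_min B₂`,
represented through the restrictions of `π₁` and `π₂`, as the subalgebra of `A₁ ⊗_min A₂`
generated by all `b₁ ⊗ b₂`. -/
noncomputable def minTensorSub (π₁ : A₁ →⋆ₐ[ℂ] (H₁ →L[ℂ] H₁)) (π₂ : A₂ →⋆ₐ[ℂ] (H₂ →L[ℂ] H₂))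
    (B₁ : StarSubalgebra ℂ A₁) (B₂ : StarSubalgebra ℂ A₂) :
    StarSubalgebra ℂ (minTensor π₁ π₂) :=
  (StarAlgebra.adjoin ℂ
    {t | ∃ b₁ ∈ B₁, ∃ b₂ ∈ B₂, t = minTmul π₁ π₂ b₁ b₂}).topologicalClosure

end Spatial

/-!
Both parts follow the same pattern. Write `E` for the big algebra (a minimal tensor product, or
`M_n(A)`) and `F` for its subalgebra.

*The norm condition is automatic.* Let `E` be finite, simple and infinite dimensional, and `x ≥ 0`
of norm `1`. If `‖(1 - g) x (1 - g)‖ ≤ 1 - ε`, then `(x - (1 - ε))₊` compressed by functional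
calculus is Cuntz below `g`. In a finite algebra a fixed nonzero element is not Cuntz below all
nonzero positive elements: `n + 1` orthogonal equivalent copies of an element, `n` of which dominate
the unit, give a proper isometry. So `g ≼ x₀` for a suitable nonzero `x₀ ≼ x` rules this out
(`IsFiniteCStar.exists_forall_lt_norm`), and only the conditions of approximation, smallness and
approximate commutation are left.

*Structure of centrally large subalgebras.* A centrally large subalgebra is simple
(`IsCentrallyLarge.isSimpleCStar`) and, in a finite algebra, has no minimal elements
(`IsCentrallyLarge.noMinimal`). Hence below every nonzero positive element of it there are
arbitrarily many orthogonal equivalent copies of some nonzero element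
(`IsSimpleCStar.exists_orthogonal_copies`).

*Tensor products.* Kirchberg's slice lemma (`exists_tmul_cuntzSubequiv`) gives, for every nonzero
`e ≥ 0` in a minimal tensor product, nonzero `a, b ≥ 0` with `a ⊗ b ≼ e`. It is proved by choosing
a product vector at which `e` does not vanish and replacing the two vector states by states which
can be excised (`exists_excision`): those almost maximizing a strictly convex perturbation of a
linear functional on the joint numerical range of the finitely many elements which occur in an
approximation of `e`.
Simplicity of `E` follows. Given `g₁` and `g₂` from the two factors, take
`g = 1 - (1 - g₁) ⊗ (1 - g₂) = g₁ ⊗ 1 + (1 - g₁) ⊗ g₂`. If `g₁` and `g₂` are small, then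
`g ≼ a ⊗ b`, since orthogonal copies under `a` and under `b` absorb the units of the other factors
(`IsSlicedTensor.exists_forall_cuntzSubequiv`).

*Matrix algebras.* Apply the cut to all matrix entries at once, and take `diag(g, …, g)`. A nonzero
`y ≥ 0` in `M_n` has a nonzero diagonal entry `a`. Orthogonal copies under `a`, spread out along the
diagonal by matrix units, give `diag(g, …, g) ≼ y` for small `g`
(`IsMatrixSystem.exists_forall_cuntzSubequiv`).
-/

attribute [local instance] CStarAlgebra.spectralOrder CStarAlgebra.spectralOrderedRing
/- Subalgebras carry the order of a C*-algebra, not the one induced from the larger algebra. -/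
attribute [-instance] Subtype.instLE Subtype.instLT Subtype.preorder Subtype.partialOrder

open scoped InnerProductSpace

/-! ### Cuntz comparison -/

section CuntzComparison

variable {D E : Type*} [CStarAlgebra D] [CStarAlgebra E]

theorem nonneg_of_map_nonneg (φ : D →⋆ₐ[ℂ] E) (hφ : Function.Injective φ) {x : D}
    (h : 0 ≤ φ x) : 0 ≤ x := by
  have hx : IsSelfAdjoint x := by
    have := IsSelfAdjoint.of_nonneg h
    rw [IsSelfAdjoint, ← map_star] at this
    exact hφ this
  rw [nonneg_iff_isSelfAdjoint_and_quasispectrumRestricts,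
    quasispectrumRestricts_iff_spectrumRestricts, SpectrumRestricts.nnreal_iff,
    ← hx.map_spectrum_real φ hφ]
  refine ⟨hx, ?_⟩
  exact fun r hr => spectrum_nonneg_of_nonneg h hr

theorem map_nonneg_starAlgHom (φ : D →⋆ₐ[ℂ] E) {x : D} (h : 0 ≤ x) : 0 ≤ φ x := by
  obtain ⟨s, rfl⟩ := CStarAlgebra.nonneg_iff_eq_star_mul_self.mp h
  rw [map_mul, map_star]
  exact star_mul_self_nonneg _

theorem norm_one_sub_le_one {g : D} (h0 : 0 ≤ g) (h1 : g ≤ 1) : ‖1 - g‖ ≤ 1 := by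
  rw [CStarAlgebra.norm_le_one_iff_of_nonneg _ (sub_nonneg.mpr h1)]
  exact sub_le_self _ h0

theorem cuntzSubequiv_iff {a b : D} :
    CuntzSubequiv a b ↔ ∀ ε : ℝ, 0 < ε → ∃ v : D, ‖v * b * star v - a‖ < ε := by
  constructor
  · rintro ⟨v, hv⟩ ε hε
    obtain ⟨n, hn⟩ := (Metric.tendsto_nhds.mp hv ε hε).exists
    exact ⟨v n, by rwa [dist_eq_norm] at hn⟩
  · intro h
    choose v hv using fun n : ℕ => h (1 / ((n : ℝ) + 1)) (by positivity)
    refine ⟨v, tendsto_iff_norm_sub_tendsto_zero.mpr ?_⟩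
    exact squeeze_zero (fun _ => norm_nonneg _) (fun n => (hv n).le)
      tendsto_one_div_add_atTop_nhds_zero_nat

theorem cuntzSubequiv_conj (v b : D) : CuntzSubequiv (v * b * star v) b :=
  ⟨fun _ => v, tendsto_const_nhds⟩

theorem CuntzSubequiv.trans {a b c : D} (hab : CuntzSubequiv a b) (hbc : CuntzSubequiv b c) :
    CuntzSubequiv a c := by
  rw [cuntzSubequiv_iff] at *
  intro ε hε
  obtain ⟨v, hv⟩ := hab (ε / 2) (by positivity)
  obtain ⟨w, hw⟩ := hbc (ε / 2 / (‖v‖ * ‖v‖ + 1)) (by positivity)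
  refine ⟨v * w, ?_⟩
  have h1 : v * w * c * star (v * w) - a
      = v * (w * c * star w - b) * star v + (v * b * star v - a) := by
    rw [star_mul]; noncomm_ring
  have h2 : ‖v * (w * c * star w - b) * star v‖ ≤ ε / 2 := by
    calc _ ≤ ‖v‖ * ‖w * c * star w - b‖ * ‖v‖ := by
          refine (norm_mul_le _ _).trans ?_
          rw [norm_star]
          gcongr
          exact norm_mul_le _ _
      _ = (‖v‖ * ‖v‖) * ‖w * c * star w - b‖ := by ring
      _ ≤ (‖v‖ * ‖v‖ + 1) * (ε / 2 / (‖v‖ * ‖v‖ + 1)) := by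
          gcongr
          linarith
      _ = ε / 2 := by field_simp
  rw [h1]
  calc _ ≤ _ := norm_add_le _ _
    _ < ε := by linarith

theorem CuntzSubequiv.map {a b : D} (h : CuntzSubequiv a b) (φ : D →⋆ₐ[ℂ] E) :
    CuntzSubequiv (φ a) (φ b) := by
  obtain ⟨v, hv⟩ := h
  refine ⟨fun n => φ (v n), ?_⟩
  have hc : Continuous φ := map_continuous φ
  simp only [← map_star, ← map_mul]
  exact (hc.tendsto a).comp hv

theorem CuntzSubequiv.smul_right {a b : D} (h : CuntzSubequiv a b) {r : ℝ} (hr : 0 < r) :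
    CuntzSubequiv a (r • b) := by
  obtain ⟨v, hv⟩ := h
  refine ⟨fun n => (√r)⁻¹ • v n, ?_⟩
  convert hv using 2 with n
  have : (√r)⁻¹ * (r * (√r)⁻¹) = 1 := by
    have h1 := Real.mul_self_sqrt hr.le
    have h2 := (Real.sqrt_pos.mpr hr).ne'
    field_simp
    nlinarith
  simp only [star_smul, smul_mul_assoc, mul_smul_comm, smul_smul, star_trivial]
  rw [this, one_smul]

theorem cuntzSubequiv_smul_self (b : D) {r : ℝ} (hr : 0 < r) : CuntzSubequiv (r • b) b := by
  have h := (cuntzSubequiv_conj (1 : D) (r • b)).smul_right (inv_pos.mpr hr)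
  simpa [smul_smul, inv_mul_cancel₀ hr.ne'] using h

/-- Dominated positive elements are Cuntz subequivalent: the contractions
`√a (b + δ)^(-1/2)` conjugate `b` to within `δ` of `a`. -/
theorem cuntzSubequiv_of_le {a b : D} (ha : 0 ≤ a) (hab : a ≤ b) : CuntzSubequiv a b := by
  rw [cuntzSubequiv_iff]
  intro ε hε
  have hb : 0 ≤ b := ha.trans hab
  set δ : ℝ := ε / 2 with hδ
  have hδ0 : 0 < δ := by positivity
  set c : D := b + algebraMap ℝ D δ with hc
  have hc0 : IsStrictlyPositive c :=
    IsStrictlyPositive.nonneg_add hb (isStrictlyPositive_algebraMap hδ0)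
  set w : D := c ^ (-(1 / 2) : ℝ) with hw
  have hwc : w * c * w = 1 := CFC.conjugate_rpow_neg_one_half c
  have hw0 : 0 ≤ w := CFC.rpow_nonneg
  have hws : star w = w := (IsSelfAdjoint.of_nonneg hw0).star_eq
  have hwbw : w * b * w = 1 - δ • (w * w) := by
    have : w * c * w = w * b * w + δ • (w * w) := by
      rw [hc, mul_add, add_mul, Algebra.algebraMap_eq_smul_one]; simp
    rw [← hwc, this]; abel
  have hwaw : ‖w * a * w‖ ≤ 1 := by
    have h1 : 0 ≤ w * a * w := by
      simpa [hws] using star_left_conjugate_nonneg ha w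
    rw [CStarAlgebra.norm_le_one_iff_of_nonneg _ h1]
    calc w * a * w ≤ w * c * w := by
          have : a ≤ c := hab.trans (le_add_of_nonneg_right (algebraMap_nonneg D hδ0.le))
          simpa [hws] using star_left_conjugate_le_conjugate this w
      _ = 1 := hwc
  have hss : star (CFC.sqrt a) = CFC.sqrt a :=
    (IsSelfAdjoint.of_nonneg (CFC.sqrt_nonneg a)).star_eq
  have hsq : CFC.sqrt a * CFC.sqrt a = a := CFC.sqrt_mul_sqrt_self a
  refine ⟨CFC.sqrt a * w, ?_⟩
  have h2 : CFC.sqrt a * w * b * star (CFC.sqrt a * w) - a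
      = - (δ • (star (w * CFC.sqrt a) * (w * CFC.sqrt a))) := by
    rw [star_mul, star_mul, hws, hss]
    calc _ = CFC.sqrt a * (w * b * w) * CFC.sqrt a - a := by noncomm_ring
      _ = CFC.sqrt a * CFC.sqrt a - a - δ • (CFC.sqrt a * (w * w) * CFC.sqrt a) := by
          rw [hwbw, mul_sub, sub_mul, mul_one, mul_smul_comm, smul_mul_assoc]; abel
      _ = _ := by rw [hsq]; simp [mul_assoc]
  rw [h2, norm_neg, norm_smul, CStarRing.norm_star_mul_self, ← CStarRing.norm_self_mul_star,
    star_mul, hws, hss]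
  have h3 : w * CFC.sqrt a * (CFC.sqrt a * w) = w * a * w := by
    rw [mul_assoc, ← mul_assoc (CFC.sqrt a), hsq, mul_assoc]
  rw [h3, Real.norm_of_nonneg hδ0.le]
  calc δ * _ ≤ δ * 1 := by gcongr
    _ < ε := by rw [hδ]; linarith

theorem CuntzSubequiv.mem_of_isClosed {a b : D} (h : CuntzSubequiv a b) {I : TwoSidedIdeal D}
    (hI : IsClosed (I : Set D)) (hb : b ∈ I) : a ∈ I := by
  obtain ⟨v, hv⟩ := h
  exact hI.mem_of_tendsto hv (Eventually.of_forall fun n =>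
    I.mul_mem_right _ _ (I.mul_mem_left _ _ hb))

end CuntzComparison

/-! ### Simple unital C*-algebras -/

section Simple

variable {D : Type*} [CStarAlgebra D]

theorem TwoSidedIdeal.one_mem_of_norm_sub_lt_one {I : TwoSidedIdeal D} {u : D} (hu : u ∈ I)
    (h : ‖1 - u‖ < 1) : (1 : D) ∈ I := by
  obtain ⟨w, hw⟩ : IsUnit u := by
    have := (Units.oneSub (1 - u) h).isUnit
    simpa using this
  have := I.mul_mem_left (↑w⁻¹ : D) u hu
  rwa [← hw, Units.inv_mul] at this

/-- A simple unital C*-algebra is algebraically simple. -/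
theorem IsSimpleCStar.one_mem (hD : IsSimpleCStar D) (I : TwoSidedIdeal D) {a : D} (ha : a ∈ I)
    (ha0 : a ≠ 0) : (1 : D) ∈ I := by
  let J : TwoSidedIdeal D := TwoSidedIdeal.mk' (closure (I : Set D))
    (subset_closure I.zero_mem)
    (fun hx hy => map_mem_closure₂ continuous_add hx hy fun _ h _ h' => I.add_mem h h')
    (fun hx => map_mem_closure continuous_neg hx fun _ h => I.neg_mem h)
    (fun {x y} hy => map_mem_closure (continuous_const_mul x) hy fun _ h =>
      I.mul_mem_left _ _ h)
    (fun {x y} hx => map_mem_closure (f := (· * y)) (continuous_mul_const y) hx fun _ h =>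
      I.mul_mem_right _ _ h)
  have hJ : (J : Set D) = closure (I : Set D) := TwoSidedIdeal.coe_mk' ..
  rcases hD.2 J (by rw [hJ]; exact isClosed_closure) with h | h
  · have : a ∈ (J : Set D) := by rw [hJ]; exact subset_closure ha
    rw [h] at this
    exact absurd this ha0
  · have h1 : (1 : D) ∈ closure (I : Set D) := by rw [← hJ, h]; trivial
    obtain ⟨u, hu, hu1⟩ := Metric.mem_closure_iff.mp h1 1 one_pos
    exact TwoSidedIdeal.one_mem_of_norm_sub_lt_one hu (by rwa [dist_eq_norm] at hu1)

theorem IsSimpleCStar.exists_sum_mul_mul_eq_one (hD : IsSimpleCStar D) {a : D} (ha0 : a ≠ 0) :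
    ∃ (n : ℕ) (x y : Fin n → D), ∑ i, x i * a * y i = 1 := by
  have h1 : (1 : D) ∈ TwoSidedIdeal.span {a} :=
    hD.one_mem _ (TwoSidedIdeal.subset_span rfl) ha0
  rw [TwoSidedIdeal.mem_span_iff_mem_addSubgroup_closure] at h1
  generalize (1 : D) = u at h1
  induction h1 using AddSubgroup.closure_induction with
  | mem u hu =>
    simp only [Set.mem_mul, Set.mem_univ, true_and, Set.mem_singleton_iff, exists_eq_left] at hu
    obtain ⟨_, ⟨x, rfl⟩, y, rfl⟩ := hu
    exact ⟨1, fun _ => x, fun _ => y, by simp⟩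
  | zero => exact ⟨0, fun _ => 0, fun _ => 0, by simp⟩
  | add u v _ _ hu hv =>
    obtain ⟨n, x, y, rfl⟩ := hu
    obtain ⟨m, x', y', rfl⟩ := hv
    exact ⟨n + m, Fin.append x x', Fin.append y y', by simp [Fin.sum_univ_add]⟩
  | neg u _ hu =>
    obtain ⟨n, x, y, rfl⟩ := hu
    exact ⟨n, fun i => -x i, y, by simp⟩

theorem IsSimpleCStar.exists_sum_conj_eq_one (hD : IsSimpleCStar D) {a : D} (ha : 0 ≤ a)
    (ha0 : a ≠ 0) : ∃ (n : ℕ) (r : Fin n → D), ∑ i, r i * a * star (r i) = 1 := by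
  obtain ⟨n, x, y, hxy⟩ := hD.exists_sum_mul_mul_eq_one ha0
  have has : star a = a := (IsSelfAdjoint.of_nonneg ha).star_eq
  -- symmetrize: `x a y + y* a x* ≤ x a x* + y* a y`
  set S : D := ∑ i, (x i * a * star (x i) + star (y i) * a * y i) with hS
  have h2 : (2 : D) ≤ S := by
    have h1 : ∑ i, star (y i) * a * star (x i) = 1 := by
      have := congrArg star hxy
      simpa [star_sum, mul_assoc, has] using this
    have : S - 2 = ∑ i, (x i - star (y i)) * a * star (x i - star (y i)) := by
      rw [← one_add_one_eq_two]
      nth_rewrite 1 [← hxy]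
      rw [← h1, hS, ← Finset.sum_add_distrib, ← Finset.sum_sub_distrib]
      refine Finset.sum_congr rfl fun i _ => ?_
      rw [star_sub, star_star]
      noncomm_ring
    rw [← sub_nonneg, this]
    exact Finset.sum_nonneg fun i _ => star_right_conjugate_nonneg ha _
  have hSpos : IsStrictlyPositive S := by
    refine IsStrictlyPositive.of_le ?_ h2
    have := isStrictlyPositive_algebraMap (A := D) (𝕜 := ℝ) (show (0 : ℝ) < 2 by norm_num)
    rwa [map_ofNat] at this
  set w : D := S ^ (-(1 / 2) : ℝ) with hw
  have hwS : w * S * w = 1 := CFC.conjugate_rpow_neg_one_half S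
  have hws : star w = w := (IsSelfAdjoint.of_nonneg CFC.rpow_nonneg).star_eq
  refine ⟨n + n, Fin.append (fun i => w * x i) (fun i => w * star (y i)), ?_⟩
  rw [Fin.sum_univ_add, ← hwS, hS]
  simp only [Fin.append_left, Fin.append_right, star_mul, star_star, hws]
  rw [← Finset.sum_add_distrib, Finset.mul_sum, Finset.sum_mul]
  refine Finset.sum_congr rfl fun i _ => ?_
  noncomm_ring

theorem IsSimpleCStar.exists_mul_mul_ne_zero (hD : IsSimpleCStar D) {a b : D} (ha : a ≠ 0)
    (hb : b ≠ 0) : ∃ x, a * x * b ≠ 0 := by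
  by_contra! h
  obtain ⟨n, x, y, hxy⟩ := hD.exists_sum_mul_mul_eq_one hb
  apply ha
  calc a = a * ∑ i, x i * b * y i := by rw [hxy, mul_one]
    _ = ∑ i, (a * x i * b) * y i := by
      rw [Finset.mul_sum]; exact Finset.sum_congr rfl fun i _ => by noncomm_ring
    _ = 0 := by simp [h]

end Simple

/-! ### Minimal elements and orthogonal pairs -/

section Minimal

variable {D : Type*} [CStarAlgebra D]

/-- A C*-algebra without minimal positive elements: no nonzero `p ≥ 0` has `p D p ⊆ ℂ p`. For a
simple unital algebra this means being infinite dimensional. -/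
def NoMinimal (D : Type*) [CStarAlgebra D] : Prop :=
  ∀ p : D, 0 ≤ p → (∀ b, ∃ c : ℂ, p * b * p = c • p) → p = 0

theorem IsSimpleCStar.noMinimal (hD : IsSimpleCStar D) (hinf : ¬ FiniteDimensional ℂ D) :
    NoMinimal D := by
  intro p hp hmin
  by_contra hp0
  apply hinf
  obtain ⟨n, r, hr⟩ := hD.exists_sum_conj_eq_one hp hp0
  rw [FiniteDimensional, Module.finite_def]
  have : (⊤ : Submodule ℂ D) =
      Submodule.span ℂ (Set.range fun ij : Fin n × Fin n => r ij.1 * p * star (r ij.2)) := by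
    refine (eq_top_iff.mpr fun x _ => ?_).symm
    have hx : x = ∑ i, ∑ j, r i * (p * (star (r i) * x * r j) * p) * star (r j) := by
      calc x = (∑ i, r i * p * star (r i)) * x * ∑ j, r j * p * star (r j) := by
            rw [hr, one_mul, mul_one]
        _ = _ := by
            simp only [Finset.sum_mul, Finset.mul_sum]
            rw [Finset.sum_comm]
            exact Finset.sum_congr rfl fun i _ => Finset.sum_congr rfl fun j _ => by noncomm_ring
    rw [hx]
    refine Submodule.sum_mem _ fun i _ => Submodule.sum_mem _ fun j _ => ?_
    obtain ⟨c, hc⟩ := hmin (star (r i) * x * r j)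
    rw [hc, mul_smul_comm, smul_mul_assoc]
    exact Submodule.smul_mem _ _ (Submodule.subset_span ⟨(i, j), rfl⟩)
  rw [this]
  exact Submodule.fg_span (Set.finite_range _)

/-- If `y D y` has no two nonzero elements with product zero, then functional calculus leaves at
most one nonzero point in the spectrum of a self-adjoint element of `y D y`. -/
theorem exists_mul_self_eq_smul_of_no_orthogonal {y : D}
    (H : ∀ b₁ b₂, y * b₁ * y * (y * b₂ * y) = 0 → y * b₁ * y = 0 ∨ y * b₂ * y = 0)
    {b : D} (hh : IsSelfAdjoint (y * b * y)) :
    ∃ μ : ℝ, (y * b * y) * (y * b * y) = μ • (y * b * y) := by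
  set h := y * b * y with hdef
  have key : ∀ μ ∈ spectrum ℝ h, ∀ ν ∈ spectrum ℝ h, μ ≠ 0 → ν ≠ 0 → μ = ν := by
    intro μ hμ ν hν hμ0 hν0
    by_contra hne
    set r := |μ - ν| / 2
    have hr : 0 < r := by have := abs_pos.mpr (sub_ne_zero.mpr hne); positivity
    have hfac : ∀ τ : ℝ, cfc (fun t => t * max 0 (r - |t - τ|) * t) h =
        y * (b * y * cfc (fun t => max 0 (r - |t - τ|)) h * y * b) * y := by
      intro τ
      rw [cfc_mul (fun t => t * max 0 (r - |t - τ|)) (fun t => t) h,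
        cfc_mul (fun t => t) (fun t => max 0 (r - |t - τ|)) h, cfc_id' ℝ h, hdef]
      noncomm_ring
    have hne0 : ∀ τ ∈ spectrum ℝ h, τ ≠ 0 →
        cfc (fun t => t * max 0 (r - |t - τ|) * t) h ≠ 0 := by
      intro τ hτ hτ0 h0
      rw [← cfc_zero ℝ h, cfc_eq_cfc_iff_eqOn] at h0
      have := h0 hτ
      simp only [sub_self, abs_zero, sub_zero, max_eq_right hr.le, Pi.zero_apply] at this
      exact absurd this (by positivity)
    have hprod : cfc (fun t => t * max 0 (r - |t - μ|) * t) h *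
        cfc (fun t => t * max 0 (r - |t - ν|) * t) h = 0 := by
      rw [← cfc_mul (fun t => t * max 0 (r - |t - μ|) * t) (fun t => t * max 0 (r - |t - ν|) * t) h,
        ← cfc_zero ℝ h]
      refine cfc_congr fun t _ => ?_
      have : r - |t - μ| ≤ 0 ∨ r - |t - ν| ≤ 0 := by
        by_contra! hc
        have h1 : |μ - ν| ≤ |t - μ| + |t - ν| := by
          calc |μ - ν| = |(t - ν) - (t - μ)| := by ring_nf
            _ ≤ |t - ν| + |t - μ| := abs_sub _ _
            _ = _ := add_comm _ _
        have : |μ - ν| = 2 * r := by simp only [r]; ring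
        linarith
      rcases this with h | h <;> simp [max_eq_left h]
    have h1 := hne0 μ hμ hμ0
    have h2 := hne0 ν hν hν0
    rw [hfac μ, hfac ν] at hprod
    rw [hfac] at h1 h2
    exact (H _ _ hprod).elim h1 h2
  by_cases hex : ∃ μ ∈ spectrum ℝ h, μ ≠ 0
  · obtain ⟨μ, hμ, hμ0⟩ := hex
    refine ⟨μ, ?_⟩
    calc h * h = cfc (fun t : ℝ => t * t) h := by
          rw [cfc_mul (fun t => t) (fun t => t) h, cfc_id' ℝ h]
      _ = cfc (fun t : ℝ => μ * t) h := by
          refine cfc_congr fun t ht => ?_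
          by_cases h0 : t = 0
          · simp [h0]
          · simp [key μ hμ t ht hμ0 h0]
      _ = μ • h := by rw [cfc_const_mul μ (fun t => t) h, cfc_id' ℝ h]
  · push Not at hex
    refine ⟨0, ?_⟩
    have : h = 0 := by
      calc h = cfc (fun t : ℝ => t) h := (cfc_id' ℝ h).symm
        _ = cfc (0 : ℝ → ℝ) h := cfc_congr fun t ht => hex t ht
        _ = 0 := cfc_zero ℝ h
    simp [this]

theorem NoMinimal.exists_orthogonal (hD : NoMinimal D) {y : D} (hy : 0 ≤ y) (hy0 : y ≠ 0) :
    ∃ b₁ b₂, y * b₁ * y ≠ 0 ∧ y * b₂ * y ≠ 0 ∧ y * b₁ * y * (y * b₂ * y) = 0 := by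
  by_contra! H'
  have H : ∀ b₁ b₂, y * b₁ * y * (y * b₂ * y) = 0 → y * b₁ * y = 0 ∨ y * b₂ * y = 0 := by
    intro b₁ b₂ h
    by_contra! hc
    exact H' b₁ b₂ hc.1 hc.2 h
  have hys : star y = y := (IsSelfAdjoint.of_nonneg hy).star_eq
  have hsa : ∀ b, IsSelfAdjoint b → IsSelfAdjoint (y * b * y) := fun b hb => by
    rw [IsSelfAdjoint, star_mul, star_mul, hb.star_eq, hys, mul_assoc]
  set p := y * y with hp
  have hp0 : p ≠ 0 := by
    intro h
    have := CStarRing.star_mul_self_eq_zero_iff y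
    rw [hys] at this
    exact hy0 (this.mp h)
  have hps : star p = p := by rw [hp, star_mul, hys]
  obtain ⟨l, hl⟩ : ∃ l : ℝ, p * p = l • p := by
    obtain ⟨l, hl⟩ := exists_mul_self_eq_smul_of_no_orthogonal H (hsa 1 (.one _))
    exact ⟨l, by simpa [hp] using hl⟩
  have hl0 : l ≠ 0 := by
    rintro rfl
    rw [zero_smul] at hl
    have := CStarRing.star_mul_self_eq_zero_iff p
    rw [hps] at this
    exact hp0 (this.mp hl)
  -- The one-point spectrum condition for `p b p + t p`, for two values of `t`, leaves only
  -- multiples of `p`.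
  have hscalar : ∀ b, IsSelfAdjoint b → ∃ c : ℝ, p * b * p = c • p := by
    intro b hb
    have hμ : ∀ t : ℝ, ∃ μ : ℝ, (p * b * p + t • p) * (p * b * p + t • p)
        = μ • (p * b * p + t • p) := by
      intro t
      have e : p * b * p + t • p = y * (y * b * y + t • 1) * y := by
        rw [hp, mul_add, add_mul]; simp [mul_assoc]
      rw [e]
      refine exists_mul_self_eq_smul_of_no_orthogonal H (hsa _ ?_)
      exact (hsa b hb).add (.smul (star_trivial t) (.one _))
    set k := p * b * p with hk
    have hkp : k * p = l • k := by rw [hk, mul_assoc, hl, mul_smul_comm]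
    have hpk : p * k = l • k := by
      rw [hk, ← mul_assoc p, ← mul_assoc p, hl, smul_mul_assoc, smul_mul_assoc]
    obtain ⟨μ₀, h₀⟩ := hμ 0
    simp only [zero_smul, add_zero] at h₀
    have hrel : ∀ t : ℝ, t ≠ 0 → (∃ c : ℝ, k = c • p) ∨ μ₀ + t * l = 0 := by
      intro t ht
      obtain ⟨μ, hμt⟩ := hμ t
      have hexp : (μ₀ + 2 * t * l - μ) • k = (t * (μ - t * l)) • p := by
        have : (k + t • p) * (k + t • p) = (μ₀ + 2 * t * l) • k + (t * t * l) • p := by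
          rw [add_mul, mul_add, mul_add, h₀, mul_smul_comm, smul_mul_assoc, hkp, hpk,
            smul_mul_smul_comm, hl]
          module
        rw [this] at hμt
        have h3 : (μ₀ + 2 * t * l - μ) • k - (t * (μ - t * l)) • p
            = ((μ₀ + 2 * t * l) • k + (t * t * l) • p) - μ • (k + t • p) := by module
        rw [← sub_eq_zero, h3, hμt, sub_self]
      by_cases hc : μ₀ + 2 * t * l - μ = 0
      · right
        rw [hc, zero_smul] at hexp
        have := (smul_eq_zero.mp hexp.symm).resolve_right hp0
        have := (mul_eq_zero.mp this).resolve_left ht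
        linarith
      · left
        refine ⟨(μ₀ + 2 * t * l - μ)⁻¹ * (t * (μ - t * l)), ?_⟩
        rw [mul_smul, ← hexp, smul_smul, inv_mul_cancel₀ hc, one_smul]
    rcases hrel 1 one_ne_zero with h | h1
    · exact h
    rcases hrel 2 two_ne_zero with h | h2
    · exact h
    exact absurd (by linarith : l = 0) hl0
  refine hp0 (hD p ?_ fun b => ?_)
  · have := star_mul_self_nonneg y
    rwa [hys] at this
  · obtain ⟨c, hc⟩ := hscalar (realPart b) (realPart b).2
    obtain ⟨d, hd⟩ := hscalar (imaginaryPart b) (imaginaryPart b).2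
    refine ⟨c + Complex.I * d, ?_⟩
    conv_lhs => rw [← realPart_add_I_smul_imaginaryPart b]
    rw [mul_add, add_mul, hc, mul_smul_comm, smul_mul_assoc, hd, add_smul, mul_smul,
      Complex.coe_smul, Complex.coe_smul]

end Minimal

/-! ### Orthogonal equivalent copies -/

section Copies

variable {D : Type*} [CStarAlgebra D]

/-- Two orthogonal equivalent elements below `y`. Simplicity connects two orthogonal elements of
`y D y` by some `u`, and then `s₁ = u √(u* u)` and `s₂ = u* u` satisfy `s₁* s₁ = s₂* s₂ = (u* u)²`
and `s₂* s₁ = 0`. -/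
theorem IsSimpleCStar.exists_orthogonal_pair (hD : IsSimpleCStar D) (hD' : NoMinimal D) {y : D}
    (hy : 0 ≤ y) (hy0 : y ≠ 0) :
    ∃ t₁ t₂ z : D, 0 ≤ z ∧ z ≠ 0 ∧ star (y * t₁) * (y * t₁) = z ∧
      star (y * t₂) * (y * t₂) = z ∧ star (y * t₂) * (y * t₁) = 0 := by
  have hys : star y = y := (IsSelfAdjoint.of_nonneg hy).star_eq
  obtain ⟨b₂, b₁, h2, h1, h21⟩ := hD'.exists_orthogonal hy hy0
  obtain ⟨b, hb⟩ := hD.exists_mul_mul_ne_zero h1 h2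
  set u := y * b₁ * y * b * (y * b₂ * y) with hu
  set a := star u * u with ha
  have ha0 : a ≠ 0 := fun h => hb ((CStarRing.star_mul_self_eq_zero_iff u).mp h)
  have hapos : 0 ≤ a := star_mul_self_nonneg u
  have has : star a = a := (IsSelfAdjoint.of_nonneg hapos).star_eq
  set q := CFC.sqrt a with hq
  have hqs : star q = q := (IsSelfAdjoint.of_nonneg (CFC.sqrt_nonneg a)).star_eq
  have hqq : q * q = a := CFC.sqrt_mul_sqrt_self a
  have e1 : y * (b₁ * y * b * (y * b₂ * y) * q) = u * q := by rw [hu]; noncomm_ring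
  have e2 : y * (star b₂ * y * star b * star (y * b₁ * y) * u) = a := by
    rw [ha]; nth_rewrite 2 [hu]
    simp only [star_mul, hys, mul_assoc]
  have hau : a * u = 0 := by
    have : a * u =
        star u * (y * b₁ * y) * b * ((y * b₂ * y) * (y * b₁ * y)) * b * (y * b₂ * y) := by
      rw [ha]; simp only [hu, mul_assoc]
    rw [this, h21]; simp
  refine ⟨b₁ * y * b * (y * b₂ * y) * q, star b₂ * y * star b * star (y * b₁ * y) * u, a * a,
    ?_, fun h => ?_, ?_, ?_, ?_⟩
  · have := star_mul_self_nonneg a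
    rwa [has] at this
  · have := CStarRing.star_mul_self_eq_zero_iff a
    rw [has] at this
    exact ha0 (this.mp h)
  · rw [e1, star_mul, hqs]
    calc q * star u * (u * q) = q * (star u * u) * q := by noncomm_ring
      _ = q * q * (q * q) := by rw [← ha, ← hqq]; noncomm_ring
      _ = a * a := by rw [hqq]
  · rw [e2, has]
  · rw [e1, e2, has, ← mul_assoc, hau, zero_mul]

/-- In a simple unital C*-algebra without minimal elements, every hereditary subalgebra
`closure (y D y)` contains arbitrarily many pairwise orthogonal, equivalent, nonzero elements
`sᵢ sᵢ*`: here `sᵢ = y tᵢ` and `sᵢ* sⱼ = δᵢⱼ z`. -/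
theorem IsSimpleCStar.exists_orthogonal_copies (hD : IsSimpleCStar D) (hD' : NoMinimal D) {y : D}
    (hy : 0 ≤ y) (hy0 : y ≠ 0) (n : ℕ) :
    ∃ (t : Fin (n + 1) → D) (z : D), 0 ≤ z ∧ z ≠ 0 ∧
      ∀ i j, star (y * t i) * (y * t j) = if i = j then z else 0 := by
  have hys : star y = y := (IsSelfAdjoint.of_nonneg hy).star_eq
  induction n with
  | zero =>
    refine ⟨fun _ => 1, star y * y, star_mul_self_nonneg y,
      fun h => hy0 ((CStarRing.star_mul_self_eq_zero_iff y).mp h), fun i j => ?_⟩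
    rw [if_pos (by omega), mul_one]
  | succ n ih =>
    obtain ⟨t, z, hz, hz0, hst⟩ := ih
    have hq : 0 ≤ CFC.sqrt z := CFC.sqrt_nonneg z
    have hqs : star (CFC.sqrt z) = CFC.sqrt z := (IsSelfAdjoint.of_nonneg hq).star_eq
    have hqq : CFC.sqrt z * CFC.sqrt z = z := CFC.sqrt_mul_sqrt_self z
    have hq0 : CFC.sqrt z ≠ 0 := fun h => hz0 (by rw [← hqq, h, mul_zero])
    obtain ⟨u₁, u₂, w, hw, hw0, h11, h22, h21⟩ := hD.exists_orthogonal_pair hD' hq hq0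
    have h12 : star (CFC.sqrt z * u₁) * (CFC.sqrt z * u₂) = 0 := by
      simpa using congrArg star h21
    have key : ∀ i j u v, star (y * (t i * u)) * (y * (t j * v))
        = if i = j then star (CFC.sqrt z * u) * (CFC.sqrt z * v) else 0 := by
      intro i j u v
      have : star (y * (t i * u)) * (y * (t j * v))
          = star u * (star (y * t i) * (y * t j)) * v := by
        simp only [star_mul, mul_assoc]
      rw [this, hst]
      split_ifs
      · rw [star_mul, hqs]; nth_rewrite 1 [← hqq]; noncomm_ring
      · simp
    refine ⟨Fin.cons (t 0 * u₂) fun i => t i * u₁, w, hw, hw0, fun i j => ?_⟩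
    refine Fin.cases ?_ (fun i => ?_) i <;> refine Fin.cases ?_ (fun j => ?_) j
    · simp only [Fin.cons_zero, key, h22, if_true]
    · simp only [Fin.cons_zero, Fin.cons_succ, key, h21, ite_self, (Fin.succ_ne_zero j).symm,
        if_false]
    · simp only [Fin.cons_zero, Fin.cons_succ, key, h12, ite_self, Fin.succ_ne_zero i, if_false]
    · simp only [Fin.cons_succ, key, h11, Fin.succ_inj]

end Copies

/-! ### Consequences of finiteness -/

section Finite

variable {D : Type*} [CStarAlgebra D]

/-- In a finite simple algebra without minimal elements nothing nonzero is Cuntz below everything.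
If `n` conjugates of `c` sum to `1` and `c ≼ z`, where `z` has `n + 1` orthogonal copies,
then `n` of these copies already dominate `1`; this gives a coisometry killing the last copy. -/
theorem IsFiniteCStar.exists_not_cuntzSubequiv (hfin : IsFiniteCStar D) (hD : IsSimpleCStar D)
    (hD' : NoMinimal D) {c x : D} (hc : 0 ≤ c) (hc0 : c ≠ 0) (hx : 0 ≤ x) (hx0 : x ≠ 0) :
    ∃ z : D, 0 ≤ z ∧ z ≠ 0 ∧ CuntzSubequiv z x ∧ ¬ CuntzSubequiv c z := by
  obtain ⟨n, r, hr⟩ := hD.exists_sum_conj_eq_one hc hc0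
  have hq : 0 ≤ CFC.sqrt x := CFC.sqrt_nonneg x
  have hqs : star (CFC.sqrt x) = CFC.sqrt x := (IsSelfAdjoint.of_nonneg hq).star_eq
  have hqq : CFC.sqrt x * CFC.sqrt x = x := CFC.sqrt_mul_sqrt_self x
  have hq0 : CFC.sqrt x ≠ 0 := fun h => hx0 (by rw [← hqq, h, mul_zero])
  obtain ⟨t, z, hz, hz0, hst⟩ := hD.exists_orthogonal_copies hD' hq hq0 n
  refine ⟨z, hz, hz0, ?_, fun hcz => ?_⟩
  · have h0 : star (t 0) * x * star (star (t 0)) = z := by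
      have := hst 0 0
      rw [if_pos rfl] at this
      rw [← this, star_mul, hqs, star_star]
      nth_rewrite 1 [← hqq]
      noncomm_ring
    rw [← h0]
    exact cuntzSubequiv_conj _ _
  set s : Fin (n + 1) → D := fun i => CFC.sqrt x * t i with hs
  have hss : ∀ i j, star (s i) * s j = if i = j then z else 0 := hst
  set R : ℝ := ∑ i, ‖r i‖ * ‖r i‖ with hR
  have hR0 : 0 ≤ R := Finset.sum_nonneg fun i _ => by positivity
  obtain ⟨v, hv⟩ := cuntzSubequiv_iff.mp hcz (1 / (R + 1)) (by positivity)
  set Y : D := ∑ i, r i * v * star (s (Fin.succ i)) with hY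
  have hYY : Y * star Y = ∑ i, r i * (v * z * star v) * star (r i) := by
    rw [hY, star_sum, Finset.sum_mul]
    refine Finset.sum_congr rfl fun i _ => ?_
    rw [Finset.mul_sum, Finset.sum_eq_single i]
    · have : r i * v * star (s (Fin.succ i)) * star (r i * v * star (s (Fin.succ i)))
          = r i * v * (star (s (Fin.succ i)) * s (Fin.succ i)) * star v * star (r i) := by
        simp only [star_mul, star_star, mul_assoc]
      rw [this, hss, if_pos rfl]
      noncomm_ring
    · intro j _ hji
      have : r i * v * star (s (Fin.succ i)) * star (r j * v * star (s (Fin.succ j)))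
          = r i * v * (star (s (Fin.succ i)) * s (Fin.succ j)) * star v * star (r j) := by
        simp only [star_mul, star_star, mul_assoc]
      rw [this, hss, if_neg (by simpa using hji.symm)]
      simp
    · simp
  have hnorm : ‖1 - Y * star Y‖ < 1 := by
    have h1 : 1 - Y * star Y = -∑ i, r i * (v * z * star v - c) * star (r i) := by
      rw [hYY, ← hr, ← Finset.sum_sub_distrib, ← Finset.sum_neg_distrib]
      exact Finset.sum_congr rfl fun i _ => by noncomm_ring
    rw [h1, norm_neg]
    calc _ ≤ ∑ i, ‖r i * (v * z * star v - c) * star (r i)‖ := norm_sum_le _ _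
      _ ≤ ∑ i, (‖r i‖ * ‖r i‖) * (1 / (R + 1)) := by
          refine Finset.sum_le_sum fun i _ => ?_
          calc _ ≤ ‖r i‖ * ‖v * z * star v - c‖ * ‖r i‖ := by
                refine (norm_mul_le _ _).trans ?_
                rw [norm_star]
                gcongr
                exact norm_mul_le _ _
            _ = (‖r i‖ * ‖r i‖) * ‖v * z * star v - c‖ := by ring
            _ ≤ _ := by gcongr
      _ = R / (R + 1) := by rw [← Finset.sum_mul]; ring
      _ < 1 := by rw [div_lt_one (by positivity)]; linarith
  have hpos : IsStrictlyPositive (Y * star Y) := by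
    refine ⟨mul_star_self_nonneg Y, ?_⟩
    have := (Units.oneSub (1 - Y * star Y) hnorm).isUnit
    simpa using this
  set w : D := (Y * star Y) ^ (-(1 / 2) : ℝ) with hw
  have hwY : w * (Y * star Y) * w = 1 := CFC.conjugate_rpow_neg_one_half (Y * star Y)
  have hws : star w = w := (IsSelfAdjoint.of_nonneg CFC.rpow_nonneg).star_eq
  have hiso := hfin (star (w * Y)) (by
    rw [star_star, star_mul, hws, ← hwY]; noncomm_ring)
  rw [star_star] at hiso
  have hYs : Y * s 0 = 0 := by
    rw [hY, Finset.sum_mul]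
    refine Finset.sum_eq_zero fun i _ => ?_
    rw [mul_assoc, hss, if_neg (Fin.succ_ne_zero i), mul_zero]
  have hs0 : s 0 = 0 := by
    calc s 0 = star (w * Y) * (w * Y) * s 0 := by rw [hiso, one_mul]
      _ = star (w * Y) * w * (Y * s 0) := by noncomm_ring
      _ = 0 := by rw [hYs, mul_zero]
  have := hss 0 0
  rw [if_pos rfl, hs0, mul_zero] at this
  exact hz0 this.symm

/-- Finiteness makes the norm condition in the definition of a centrally large subalgebra
automatic: if `(1 - g) x (1 - g)` had small norm, then `g` would dominate a spectral piece of `x`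
near `1`, which cannot be small in the sense of Cuntz comparison. -/
theorem IsFiniteCStar.exists_forall_lt_norm (hfin : IsFiniteCStar D) (hD : IsSimpleCStar D)
    (hD' : NoMinimal D) {x : D} (hx : 0 ≤ x) (hx1 : ‖x‖ = 1) {ε : ℝ} (hε : 0 < ε) :
    ∃ x₀ : D, 0 ≤ x₀ ∧ x₀ ≠ 0 ∧ CuntzSubequiv x₀ x ∧
      ∀ g : D, 0 ≤ g → g ≤ 1 → CuntzSubequiv g x₀ → 1 - ε < ‖(1 - g) * x * (1 - g)‖ := by
  have := hD.1
  have hxsa : IsSelfAdjoint x := .of_nonneg hx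
  have hx0 : x ≠ 0 := by rintro rfl; simp at hx1
  set k : ℝ → ℝ := fun t => max 0 (t - (1 - ε)) with hk
  have hkc : Continuous k := by fun_prop
  set c := cfc k x with hc
  have hcs : star c = c := (IsSelfAdjoint.of_nonneg
    (cfc_nonneg (fun t _ => le_max_left _ _))).star_eq
  set C := cfc (fun t => k t * k t * k t) x with hC
  have hC0 : 0 ≤ C := cfc_nonneg (fun t _ => by
    have : 0 ≤ k t := le_max_left _ _
    positivity)
  have hCne : C ≠ 0 := by
    intro h
    rw [hC, ← cfc_zero ℝ x, cfc_eq_cfc_iff_eqOn] at h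
    have h1 : (1 : ℝ) ∈ spectrum ℝ x := by
      have := CStarAlgebra.norm_mem_spectrum_of_nonneg (a := x)
      rwa [hx1] at this
    have := h h1
    simp only [hk, Pi.zero_apply] at this
    rw [show max 0 ((1 : ℝ) - (1 - ε)) = ε by rw [max_eq_right] <;> linarith] at this
    exact absurd this (by positivity)
  have hCeq : C = c * (x - algebraMap ℝ D (1 - ε)) * c := by
    have h1 : x - algebraMap ℝ D (1 - ε) = cfc (fun t => t - (1 - ε)) x := by
      rw [cfc_sub (fun t => t) (fun _ => 1 - ε) x, cfc_id' ℝ x, cfc_const (1 - ε) x]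
    rw [h1, hc, ← cfc_mul k (fun t => t - (1 - ε)) x,
      ← cfc_mul (fun t => k t * (t - (1 - ε))) k x, hC]
    refine cfc_congr fun t _ => ?_
    simp only [hk]
    rcases le_total (t - (1 - ε)) 0 with h | h
    · simp [max_eq_left h]
    · simp only [max_eq_right h]
  obtain ⟨x₀, h0, hne, hx₀x, hnot⟩ :=
    hfin.exists_not_cuntzSubequiv hD hD' hC0 hCne hx hx0
  refine ⟨x₀, h0, hne, hx₀x, fun g hg hg1 hgx => ?_⟩
  by_contra! hle
  apply hnot
  have hgs : star g = g := (IsSelfAdjoint.of_nonneg hg).star_eq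
  set s := CFC.sqrt x with hsdef
  have hss : star s = s := (IsSelfAdjoint.of_nonneg (CFC.sqrt_nonneg x)).star_eq
  have hsq : s * s = x := CFC.sqrt_mul_sqrt_self x
  set d := (1 - g) * s with hd
  have hds : star d = s * (1 - g) := by rw [hd, star_mul, star_sub, star_one, hgs, hss]
  have hnorm : ‖star d * d‖ ≤ 1 - ε := by
    rw [CStarRing.norm_star_mul_self, ← CStarRing.norm_self_mul_star]
    have : d * star d = (1 - g) * x * (1 - g) := by rw [hds, hd, ← hsq]; noncomm_ring
    rwa [this]
  have h1ε : 0 ≤ 1 - ε := (norm_nonneg _).trans hnorm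
  have hdle : star d * d ≤ algebraMap ℝ D (1 - ε) :=
    (CStarAlgebra.norm_le_iff_le_algebraMap _ h1ε (star_mul_self_nonneg d)).mp hnorm
  have hgg : 0 ≤ s * (g * g) * s := by
    have := star_mul_self_nonneg (g * s)
    rw [star_mul, hss, hgs] at this
    convert this using 1
    noncomm_ring
  have hxle : x - algebraMap ℝ D (1 - ε) ≤ (2 : ℝ) • (s * g * s) := by
    have e : (2 : ℝ) • (s * g * s) - x = s * (g * g) * s - star d * d := by
      rw [hds, hd, two_smul, ← hsq]; noncomm_ring
    have : 0 ≤ (2 : ℝ) • (s * g * s) - (x - algebraMap ℝ D (1 - ε)) := by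
      have e2 : (2 : ℝ) • (s * g * s) - (x - algebraMap ℝ D (1 - ε))
          = s * (g * g) * s + (algebraMap ℝ D (1 - ε) - star d * d) := by
        rw [sub_sub_eq_add_sub, add_sub_right_comm, e]; abel
      rw [e2]
      exact add_nonneg hgg (sub_nonneg.mpr hdle)
    exact sub_nonneg.mp this
  have hCle : C ≤ (2 : ℝ) • ((c * s) * g * star (c * s)) := by
    rw [hCeq]
    have := star_left_conjugate_le_conjugate hxle c
    rw [hcs] at this
    refine this.trans_eq ?_
    rw [star_mul, hss, hcs, mul_smul_comm, smul_mul_assoc]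
    congr 1
    noncomm_ring
  exact ((cuntzSubequiv_of_le hC0 hCle).trans ((cuntzSubequiv_smul_self _ two_pos).trans
    (cuntzSubequiv_conj _ _))).trans hgx

end Finite

/-! ### Simplicity of centrally large subalgebras, absence of minimal elements -/

section CentrallyLarge

variable {A : Type*} [CStarAlgebra A] {B : StarSubalgebra ℂ A} [IsClosed (B : Set A)]

theorem StarSubalgebra.coe_nonneg_iff {y : B} : 0 ≤ (y : A) ↔ 0 ≤ y :=
  ⟨nonneg_of_map_nonneg B.subtype Subtype.val_injective, map_nonneg_starAlgHom B.subtype⟩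

theorem StarSubalgebra.coe_le_coe_iff {x y : B} : (x : A) ≤ y ↔ x ≤ y := by
  rw [← sub_nonneg, ← sub_nonneg (a := y), ← StarSubalgebra.coe_nonneg_iff]
  rfl

theorem TwoSidedIdeal.exists_ne_zero_of_ne_bot {R : Type*} [Ring R] {I : TwoSidedIdeal R}
    (h : I ≠ ⊥) : ∃ b ∈ I, b ≠ 0 := by
  by_contra! hc
  refine h (TwoSidedIdeal.ext fun x => ?_)
  rw [TwoSidedIdeal.mem_bot]
  exact ⟨hc x, fun hx => hx ▸ I.zero_mem⟩

/-- A centrally large subalgebra is simple: if `∑ rₖ y rₖ* = 1` in `A`, cut the `rₖ` into `B` by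
some `1 - g` with `g ≼ y`. Both `g` and `(1 - g)²` are then close to the closed ideal of `B`
generated by `y`. -/
theorem IsCentrallyLarge.isSimpleCStar (hB : IsCentrallyLarge B) : IsSimpleCStar B := by
  have hA := hB.simple
  have := hA.1
  refine ⟨inferInstance, fun I hI => ?_⟩
  by_contra! hc
  obtain ⟨b, hbI, hb0⟩ := TwoSidedIdeal.exists_ne_zero_of_ne_bot hc.1
  set y : B := star b * b with hy
  have hyI : y ∈ I := I.mul_mem_left _ _ hbI
  have hy0 : y ≠ 0 := fun h => hb0 ((CStarRing.star_mul_self_eq_zero_iff b).mp h)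
  have hypos : 0 ≤ (y : A) := StarSubalgebra.coe_nonneg_iff.mpr (star_mul_self_nonneg b)
  have hyA : (y : A) ≠ 0 := fun h => hy0 (Subtype.ext h)
  obtain ⟨n, r, hr⟩ := hA.exists_sum_conj_eq_one hypos hyA
  have hn : 0 < n := by
    rcases Nat.eq_zero_or_pos n with rfl | h
    · simp at hr
    · exact h
  -- a perturbation of the `rₖ` keeps `∑ rₖ y rₖ*` within `1` of `1`
  obtain ⟨ε, hε, hcont⟩ : ∃ ε > 0, ∀ c : Fin n → A, (∀ j, ‖c j - r j‖ < ε) →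
      ‖1 - ∑ i, c i * (y : A) * star (c i)‖ < 1 := by
    have h1 : Continuous fun c : Fin n → A => 1 - ∑ i, c i * (y : A) * star (c i) := by fun_prop
    have h2 := (h1.norm.tendsto r).eventually_lt_const (u := 1) (by simp [hr])
    obtain ⟨ε, hε, h3⟩ := Metric.eventually_nhds_iff.mp h2
    refine ⟨ε, hε, fun c hc => h3 ?_⟩
    rw [dist_pi_lt_iff hε]
    exact fun j => by rw [dist_eq_norm]; exact hc j
  obtain ⟨c, g, ⟨hg0, hg1⟩, hca, hcB, ⟨hgy, -⟩, -, -⟩ :=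
    hB.cut n hn r ε hε 1 zero_le_one norm_one y hypos hy0
  have hgI : g ∈ I := CuntzSubequiv.mem_of_isClosed hgy hI hyI
  have hgs : star (g : A) = g := (IsSelfAdjoint.of_nonneg hg0).star_eq
  set d : Fin n → B := fun i => ⟨(1 - (g : A)) * c i, hcB i⟩
  set u : B := ∑ i, d i * y * star (d i) + (g + g - g * g) with hu
  have huI : u ∈ I := by
    refine I.add_mem (sum_mem fun i _ => I.mul_mem_right _ _ (I.mul_mem_left _ _ hyI)) ?_
    exact I.sub_mem (I.add_mem hgI hgI) (I.mul_mem_left _ _ hgI)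
  have hnorm : ‖1 - u‖ < 1 := by
    have e : ((1 - u : B) : A)
        = (1 - (g : A)) * (1 - ∑ i, c i * (y : A) * star (c i)) * (1 - (g : A)) := by
      have : ((∑ i, d i * y * star (d i) : B) : A)
          = (1 - (g : A)) * (∑ i, c i * (y : A) * star (c i)) * (1 - (g : A)) := by
        rw [AddSubmonoidClass.coe_finsetSum, Finset.mul_sum, Finset.sum_mul]
        refine Finset.sum_congr rfl fun i _ => ?_
        simp only [d, MulMemClass.coe_mul, StarMemClass.coe_star, star_mul, star_sub, star_one,
          hgs, mul_assoc]
      have e2 : ∀ G S : A, (1 - G) * (1 - S) * (1 - G)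
          = (1 - G) * (1 - G) - (1 - G) * S * (1 - G) :=
        fun G S => by noncomm_ring
      rw [e2, ← this, hu]
      push_cast
      noncomm_ring
    have h1g : ‖1 - (g : A)‖ ≤ 1 := norm_one_sub_le_one hg0 hg1
    calc ‖1 - u‖ = ‖((1 - u : B) : A)‖ := rfl
      _ ≤ 1 * ‖1 - ∑ i, c i * (y : A) * star (c i)‖ * 1 := by
        rw [e]
        refine (norm_mul_le _ _).trans ?_
        gcongr
        exact (norm_mul_le _ _).trans (by gcongr)
      _ < 1 := by simpa using hcont c hca
  exact hc.2 ((TwoSidedIdeal.one_mem_iff I).mp (TwoSidedIdeal.one_mem_of_norm_sub_lt_one huI hnorm))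

/-- A centrally large subalgebra of a finite algebra has no minimal elements. If `p` were minimal
in `B`, then `p ≼ g` for every nonzero `g ∈ B₊`, whereas there are nonzero `g ∈ B₊` which are
arbitrarily small in `A` as soon as `B ≠ A`. -/
theorem IsCentrallyLarge.noMinimal (hB : IsCentrallyLarge B) (hfin : IsFiniteCStar A) :
    NoMinimal B := by
  have hA := hB.simple
  have := hA.1
  have hAm := hA.noMinimal hB.infinite
  have hBs := hB.isSimpleCStar
  intro p hp hmin
  by_contra hp0
  have hpA : 0 ≤ (p : A) := StarSubalgebra.coe_nonneg_iff.mpr hp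
  have hpA0 : (p : A) ≠ 0 := fun h => hp0 (Subtype.ext h)
  by_cases hall : ∀ a : A, a ∈ B
  · refine hpA0 (hAm p hpA fun b => ?_)
    obtain ⟨c, hc⟩ := hmin ⟨b, hall b⟩
    exact ⟨c, congrArg Subtype.val hc⟩
  push Not at hall
  obtain ⟨a, ha⟩ := hall
  obtain ⟨ε, hε, hεa⟩ : ∃ ε > 0, ∀ c ∈ B, ε ≤ ‖c - a‖ := by
    by_contra! hc
    refine ha (hB.closed.closure_subset (Metric.mem_closure_iff.mpr fun ε hε => ?_))
    obtain ⟨c, hcB, hca⟩ := hc ε hε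
    exact ⟨c, hcB, by rwa [dist_comm, dist_eq_norm]⟩
  obtain ⟨z, hz, hz0, -, hnot⟩ :=
    hfin.exists_not_cuntzSubequiv hA hAm hpA hpA0 zero_le_one one_ne_zero
  have hzn : 0 < ‖z‖⁻¹ := inv_pos.mpr (norm_pos_iff.mpr hz0)
  obtain ⟨c, g, ⟨hg0, hg1⟩, hca, hcB, ⟨-, hgz⟩, -, -⟩ :=
    hB.cut 1 one_pos (fun _ => a) ε hε (‖z‖⁻¹ • z) (smul_nonneg hzn.le hz)
      (by rw [norm_smul, Real.norm_of_nonneg hzn.le, inv_mul_cancel₀ (norm_ne_zero_iff.mpr hz0)])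
      p hpA hp0
  have hgne : g ≠ 0 := by
    rintro rfl
    refine absurd (hca 0) (not_lt.mpr (hεa _ ?_))
    simpa using hcB 0
  have hgB : 0 ≤ g := StarSubalgebra.coe_nonneg_iff.mp hg0
  have hps : star p = p := (IsSelfAdjoint.of_nonneg hp).star_eq
  set s := CFC.sqrt g
  have hss : star s = s := (IsSelfAdjoint.of_nonneg (CFC.sqrt_nonneg g)).star_eq
  have hsq : s * s = g := CFC.sqrt_mul_sqrt_self g
  have hs0 : s ≠ 0 := fun h => hgne (by rw [← hsq, h, mul_zero])
  obtain ⟨b, hb⟩ := hBs.exists_mul_mul_ne_zero hs0 hp0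
  obtain ⟨l, hl⟩ := hmin (star b * g * b)
  have hl' : star (s * b * p) * (s * b * p) = l • p := by
    rw [← hl, ← hsq]
    simp only [star_mul, hss, hps, mul_assoc]
  have hl0 : l ≠ 0 := by
    rintro rfl
    rw [zero_smul] at hl'
    exact hb ((CStarRing.star_mul_self_eq_zero_iff _).mp hl')
  -- `‖l‖ p` is the positive element `l p`, by uniqueness of positive square roots of `(l p)²`
  have hlp : l • p = ‖l‖ • p := by
    have h1 : 0 ≤ l • p := hl' ▸ star_mul_self_nonneg _
    have h2 : 0 ≤ ‖l‖ • p := smul_nonneg (norm_nonneg _) hp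
    have h3 : star (l • p) = l • p := (IsSelfAdjoint.of_nonneg h1).star_eq
    have h4 : (l • p) * (l • p) = (‖l‖ • p) * (‖l‖ • p) := by
      have : (l • p) * (l • p) = star (l • p) * (l • p) := by rw [h3]
      rw [this, star_smul, hps, smul_mul_smul_comm, smul_mul_smul_comm, ← Complex.coe_smul]
      congr 1
      rw [Complex.star_def, ← Complex.normSq_eq_conj_mul_self, Complex.normSq_eq_norm_sq]
      push_cast
      ring
    rw [← CFC.sqrt_mul_self (l • p) h1, h4, CFC.sqrt_mul_self (‖l‖ • p) h2]
  have hpg : CuntzSubequiv p g := by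
    have h5 : CuntzSubequiv (‖l‖ • p) g := by
      have : ‖l‖ • p = (p * star b) * g * star (p * star b) := by
        rw [← hlp, ← hl, star_mul, star_star, hps]; noncomm_ring
      rw [this]
      exact cuntzSubequiv_conj _ _
    have h6 := (cuntzSubequiv_smul_self (‖l‖ • p) (inv_pos.mpr (norm_pos_iff.mpr hl0))).trans h5
    rwa [smul_smul, inv_mul_cancel₀ (norm_ne_zero_iff.mpr hl0), one_smul] at h6
  exact hnot (((hpg.map B.subtype).trans hgz).trans (cuntzSubequiv_smul_self z hzn))

end CentrallyLarge

theorem sqrt_spec {D : Type*} [CStarAlgebra D] {a : D} (ha : 0 ≤ a) (ha0 : a ≠ 0) :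
    0 ≤ CFC.sqrt a ∧ CFC.sqrt a ≠ 0 ∧ ∀ s t : D,
      star (CFC.sqrt a * s) * (CFC.sqrt a * t) = star s * a * t := by
  have hq : 0 ≤ CFC.sqrt a := CFC.sqrt_nonneg a
  have hqs : star (CFC.sqrt a) = CFC.sqrt a := (IsSelfAdjoint.of_nonneg hq).star_eq
  have hqq : CFC.sqrt a * CFC.sqrt a = a := CFC.sqrt_mul_sqrt_self a
  refine ⟨hq, fun h => ha0 (by rw [← hqq, h, mul_zero]), fun s t => ?_⟩
  calc _ = star s * (CFC.sqrt a * CFC.sqrt a) * t := by rw [star_mul, hqs]; noncomm_ring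
    _ = _ := by rw [hqq]

/-! ### Tensor products with a slice lemma -/

section TensorPair

variable {D₁ D₂ E : Type*} [CStarAlgebra D₁] [CStarAlgebra D₂] [CStarAlgebra E]

variable {ι₁ : D₁ →⋆ₐ[ℂ] E} {ι₂ : D₂ →⋆ₐ[ℂ] E}

theorem tmul_mul_tmul (h : ∀ a b, Commute (ι₁ a) (ι₂ b)) (a a' : D₁) (b b' : D₂) :
    ι₁ a * ι₂ b * (ι₁ a' * ι₂ b') = ι₁ (a * a') * ι₂ (b * b') := by
  rw [map_mul, map_mul, mul_assoc, ← mul_assoc (ι₂ b), ← (h a' b).eq]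
  noncomm_ring

theorem star_tmul (h : ∀ a b, Commute (ι₁ a) (ι₂ b)) (a : D₁) (b : D₂) :
    star (ι₁ a * ι₂ b) = ι₁ (star a) * ι₂ (star b) := by
  rw [star_mul, ← map_star, ← map_star, (h _ _).eq]

theorem tmul_nonneg (h : ∀ a b, Commute (ι₁ a) (ι₂ b)) {a : D₁} {b : D₂} (ha : 0 ≤ a)
    (hb : 0 ≤ b) : 0 ≤ ι₁ a * ι₂ b := by
  obtain ⟨s, rfl⟩ := CStarAlgebra.nonneg_iff_eq_star_mul_self.mp ha
  obtain ⟨t, rfl⟩ := CStarAlgebra.nonneg_iff_eq_star_mul_self.mp hb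
  rw [← tmul_mul_tmul h, ← star_tmul h]
  exact star_mul_self_nonneg _

theorem norm_tmul_le (a : D₁) (b : D₂) : ‖ι₁ a * ι₂ b‖ ≤ ‖a‖ * ‖b‖ :=
  (norm_mul_le _ _).trans (by
    gcongr
    exacts [NonUnitalStarAlgHom.norm_apply_le ι₁ a, NonUnitalStarAlgHom.norm_apply_le ι₂ b])

/-- The properties of a minimal tensor product `E` of `D₁` and `D₂` used below: commuting copies
of `D₁` and `D₂` in `E` such that every nonzero positive element of `E` dominates, in the sense of
Cuntz comparison, an elementary tensor `a ⊗ b = ι₁ a * ι₂ b` of nonzero positive elements. The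
latter is Kirchberg's slice lemma. -/
structure IsSlicedTensor (ι₁ : D₁ →⋆ₐ[ℂ] E) (ι₂ : D₂ →⋆ₐ[ℂ] E) : Prop where
  commute : ∀ a b, Commute (ι₁ a) (ι₂ b)
  slice : ∀ e : E, 0 ≤ e → e ≠ 0 → ∃ (a : D₁) (b : D₂), 0 ≤ a ∧ a ≠ 0 ∧ 0 ≤ b ∧ b ≠ 0 ∧
    CuntzSubequiv (ι₁ a * ι₂ b) e

namespace IsSlicedTensor

theorem isSimpleCStar [Nontrivial E] (h : IsSlicedTensor ι₁ ι₂) (h₁ : IsSimpleCStar D₁)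
    (h₂ : IsSimpleCStar D₂) : IsSimpleCStar E := by
  refine ⟨inferInstance, fun I hI => ?_⟩
  by_contra! hc
  obtain ⟨c, hcI, hc0⟩ := TwoSidedIdeal.exists_ne_zero_of_ne_bot hc.1
  obtain ⟨a, b, ha, ha0, hb, hb0, hab⟩ := h.slice (star c * c) (star_mul_self_nonneg c)
    fun h => hc0 ((CStarRing.star_mul_self_eq_zero_iff c).mp h)
  have habI : ι₁ a * ι₂ b ∈ I := hab.mem_of_isClosed hI (I.mul_mem_left _ _ hcI)
  obtain ⟨n, r, hr⟩ := h₁.exists_sum_conj_eq_one ha ha0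
  obtain ⟨m, s, hs⟩ := h₂.exists_sum_conj_eq_one hb hb0
  apply hc.2
  rw [← TwoSidedIdeal.one_mem_iff]
  have : (1 : E) = ∑ i, ∑ j, ι₁ (r i) * ι₂ (s j) * (ι₁ a * ι₂ b) *
      (ι₁ (star (r i)) * ι₂ (star (s j))) := by
    simp only [tmul_mul_tmul h.commute]
    simp only [← Finset.mul_sum, ← map_sum, hr, hs, map_one, mul_one]
  rw [this]
  exact sum_mem fun i _ => sum_mem fun j _ => I.mul_mem_right _ _ (I.mul_mem_left _ _ habI)

/-- Below every nonzero `e ≥ 0` there is room for `g₁ ⊗ 1 + (1 - g₁) ⊗ g₂` with `g₁`, `g₂` small.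
Given `a₁ ⊗ a₂ ≼ e`, the element `a₁` dominates orthogonal copies of some `z`. As
many of these as there are copies of `a₂` needed to dominate `1` give room for `z ⊗ 1`, and one
further copy gives, in the same way, room for `1 ⊗ z₂`. -/
theorem exists_forall_cuntzSubequiv (h : IsSlicedTensor ι₁ ι₂) (h₁ : IsSimpleCStar D₁)
    (h₂ : IsSimpleCStar D₂) (hm₁ : NoMinimal D₁) (hm₂ : NoMinimal D₂) {e : E} (he : 0 ≤ e)
    (he0 : e ≠ 0) :
    ∃ (z₁ : D₁) (z₂ : D₂), 0 ≤ z₁ ∧ z₁ ≠ 0 ∧ 0 ≤ z₂ ∧ z₂ ≠ 0 ∧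
      ∀ g₁ g₂, g₁ ≤ 1 → CuntzSubequiv g₁ z₁ → CuntzSubequiv g₂ z₂ →
        CuntzSubequiv (1 - ι₁ (1 - g₁) * ι₂ (1 - g₂)) e := by
  obtain ⟨a₁, a₂, ha₁, ha₁0, ha₂, ha₂0, hae⟩ := h.slice e he he0
  obtain ⟨n₂, r, hr⟩ := h₂.exists_sum_conj_eq_one ha₂ ha₂0
  obtain ⟨hp, hp0, hpp⟩ := sqrt_spec ha₁ ha₁0
  obtain ⟨t, z, hz, hz0, hst⟩ := h₁.exists_orthogonal_copies hm₁ hp hp0 n₂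
  simp only [hpp] at hst
  obtain ⟨n₁, q, hq⟩ := h₁.exists_sum_conj_eq_one hz hz0
  obtain ⟨hp', hp0', hpp'⟩ := sqrt_spec ha₂ ha₂0
  obtain ⟨u, z₂, hz₂, hz₂0, hsu⟩ := h₂.exists_orthogonal_copies hm₂ hp' hp0' n₁
  simp only [hpp'] at hsu
  refine ⟨z, z₂, hz, hz0, hz₂, hz₂0, fun g₁ g₂ hg₁ hgz hgz₂ => ?_⟩
  refine CuntzSubequiv.trans ?_ hae
  set W : E := ∑ i, ι₁ (star (t (Fin.succ i))) * ι₂ (r i) with hW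
  set V : E := ∑ k, ι₁ (q k * star (t 0)) * ι₂ (star (u (Fin.castSucc k))) with hV
  have hWW : W * (ι₁ a₁ * ι₂ a₂) * star W = ι₁ z := by
    simp only [hW, star_sum, star_tmul h.commute, Finset.sum_mul, Finset.mul_sum,
      tmul_mul_tmul h.commute, star_star, hst, Fin.succ_inj]
    calc _ = ∑ i, ι₁ z * ι₂ (r i * a₂ * star (r i)) := by
          refine Finset.sum_congr rfl fun i _ => ?_
          rw [Finset.sum_eq_single i]
          · simp
          · intro j _ hji
            simp [hji]
          · simp
      _ = ι₁ z := by rw [← Finset.mul_sum, ← map_sum, hr, map_one, mul_one]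
  have hVV : V * (ι₁ a₁ * ι₂ a₂) * star V = ι₂ z₂ := by
    simp only [hV, star_sum, star_tmul h.commute, Finset.sum_mul, Finset.mul_sum,
      tmul_mul_tmul h.commute, star_star, hsu, Fin.castSucc_inj]
    calc _ = ∑ k, ι₁ (q k * z * star (q k)) * ι₂ z₂ := by
          refine Finset.sum_congr rfl fun k _ => ?_
          rw [Finset.sum_eq_single k]
          · have := hst 0 0
            rw [if_pos rfl] at this
            rw [if_pos rfl, ← this, star_mul, star_star]
            congr 2
            noncomm_ring
          · intro j _ hji
            simp [hji]
          · simp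
      _ = ι₂ z₂ := by rw [← Finset.sum_mul, ← map_sum, hq, map_one, one_mul]
  have hWV : W * (ι₁ a₁ * ι₂ a₂) * star V = 0 := by
    simp only [hW, hV, star_sum, star_tmul h.commute, Finset.sum_mul, Finset.mul_sum,
      tmul_mul_tmul h.commute]
    refine Finset.sum_eq_zero fun i _ => Finset.sum_eq_zero fun k _ => ?_
    have := hst (Fin.succ k) 0
    rw [if_neg (Fin.succ_ne_zero k)] at this
    rw [star_mul, star_star, ← mul_assoc, this]
    simp
  have hVW : V * (ι₁ a₁ * ι₂ a₂) * star W = 0 := by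
    have := congrArg star hWV
    rw [star_mul, star_mul, star_star, star_tmul h.commute,
      (IsSelfAdjoint.of_nonneg ha₁).star_eq, (IsSelfAdjoint.of_nonneg ha₂).star_eq,
      star_zero] at this
    rw [mul_assoc, this]
  obtain ⟨v, hv⟩ := hgz
  obtain ⟨w, hw⟩ := hgz₂
  set s := CFC.sqrt (1 - g₁)
  have hss : star s = s := (IsSelfAdjoint.of_nonneg (CFC.sqrt_nonneg _)).star_eq
  have hsq : s * s = 1 - g₁ := CFC.sqrt_mul_sqrt_self _ (sub_nonneg.mpr hg₁)
  refine ⟨fun n => ι₁ (v n) * W + ι₁ s * ι₂ (w n) * V, ?_⟩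
  have hlim : Tendsto (fun n => ι₁ (v n * z * star (v n)) +
      ι₁ (1 - g₁) * ι₂ (w n * z₂ * star (w n))) atTop (𝓝 (ι₁ g₁ + ι₁ (1 - g₁) * ι₂ g₂)) := by
    have hc₁ : Continuous ι₁ := map_continuous ι₁
    have hc₂ : Continuous ι₂ := map_continuous ι₂
    exact ((hc₁.tendsto _).comp hv).add (((hc₂.tendsto _).comp hw).const_mul _)
  have hlimeq : 1 - ι₁ (1 - g₁) * ι₂ (1 - g₂) = ι₁ g₁ + ι₁ (1 - g₁) * ι₂ g₂ := by
    simp only [map_sub, map_one]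
    noncomm_ring
  rw [hlimeq]
  refine hlim.congr fun n => ?_
  set X := ι₁ a₁ * ι₂ a₂
  have e1 : ι₁ (v n * z * star (v n)) = ι₁ (v n) * (W * X * star W) * star (ι₁ (v n)) := by
    rw [hWW, map_mul, map_mul, map_star]
  have e2 : ι₁ (1 - g₁) * ι₂ (w n * z₂ * star (w n))
      = (ι₁ s * ι₂ (w n)) * (V * X * star V) * star (ι₁ s * ι₂ (w n)) := by
    have hone : ι₂ z₂ = ι₁ 1 * ι₂ z₂ := by rw [map_one, one_mul]
    rw [hVV, star_tmul h.commute, hone, tmul_mul_tmul h.commute, tmul_mul_tmul h.commute, hss,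
      mul_one, hsq]
  rw [e1, e2]
  symm
  calc _ = ι₁ (v n) * (W * X * star W) * star (ι₁ (v n))
        + ι₁ (v n) * (W * X * star V) * star (ι₁ s * ι₂ (w n))
        + (ι₁ s * ι₂ (w n)) * (V * X * star W) * star (ι₁ (v n))
        + (ι₁ s * ι₂ (w n)) * (V * X * star V) * star (ι₁ s * ι₂ (w n)) := by
        simp only [star_add, star_mul]
        noncomm_ring
    _ = _ := by rw [hWV, hVW]; simp

end IsSlicedTensor

theorem IsSimpleCStar.injective [Nontrivial E] (h : IsSimpleCStar D₁) (φ : D₁ →⋆ₐ[ℂ] E) :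
    Function.Injective φ := by
  rw [injective_iff_map_eq_zero]
  intro a ha
  by_contra ha0
  have h1 := h.one_mem (TwoSidedIdeal.ker φ) ((TwoSidedIdeal.mem_ker φ).mpr ha) ha0
  rw [TwoSidedIdeal.mem_ker, map_one] at h1
  exact one_ne_zero h1

theorem IsFiniteCStar.of_injective (h : IsFiniteCStar E) (φ : D₁ →⋆ₐ[ℂ] E)
    (hφ : Function.Injective φ) : IsFiniteCStar D₁ := by
  intro v hv
  apply hφ
  have := h (φ v) (by rw [← map_star, ← map_mul, hv, map_one])
  rwa [← map_star, ← map_mul, ← map_one φ] at this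

end TensorPair

/-! ### The cut for arbitrary finite families -/

section Cut

variable {A : Type*} [CStarAlgebra A] {B : StarSubalgebra ℂ A}

/-- The defining property of centrally large subalgebras for families indexed by any finite type,
and with `x` only assumed nonzero at the cost of the norm condition. -/
theorem IsCentrallyLarge.exists_cut [IsClosed (B : Set A)] (hB : IsCentrallyLarge B) {κ : Type*}
    [Finite κ] (a : κ → A) {ε : ℝ} (hε : 0 < ε) {x : A} (hx : 0 ≤ x) (hx0 : x ≠ 0) {y : B}
    (hy : 0 ≤ y) (hy0 : y ≠ 0) :
    ∃ (c : κ → A) (g : B), 0 ≤ g ∧ g ≤ 1 ∧ (∀ j, ‖c j - a j‖ < ε) ∧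
      (∀ j, (1 - (g : A)) * c j ∈ B) ∧ CuntzSubequiv g y ∧ CuntzSubequiv (g : A) x ∧
      (∀ j, ‖(g : A) * a j - a j * (g : A)‖ < ε) := by
  have := Fintype.ofFinite κ
  -- one more index makes the family nonempty
  let f : Fin (Fintype.card (Option κ)) → A := fun i =>
    ((Fintype.equivFin (Option κ)).symm i).elim 0 a
  have hf : ∀ k, f (Fintype.equivFin _ (some k)) = a k := fun k => by simp [f]
  have hzn : 0 < ‖x‖⁻¹ := inv_pos.mpr (norm_pos_iff.mpr hx0)
  obtain ⟨c, g, ⟨hg0, hg1⟩, hca, hcB, ⟨hgy, hgx⟩, -, hcomm⟩ :=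
    hB.cut _ Fintype.card_pos f ε hε (‖x‖⁻¹ • x) (smul_nonneg hzn.le hx)
      (by rw [norm_smul, Real.norm_of_nonneg hzn.le, inv_mul_cancel₀ (norm_ne_zero_iff.mpr hx0)])
      y (StarSubalgebra.coe_nonneg_iff.mpr hy) hy0
  refine ⟨fun k => c (Fintype.equivFin _ (some k)), g, StarSubalgebra.coe_nonneg_iff.mp hg0, ?_,
    fun k => ?_, fun k => hcB _, hgy, hgx.trans (cuntzSubequiv_smul_self x hzn), fun k => ?_⟩
  · rw [← sub_nonneg, ← StarSubalgebra.coe_nonneg_iff]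
    simpa using hg1
  · have := hca (Fintype.equivFin _ (some k))
    rwa [hf] at this
  · have := hcomm (Fintype.equivFin _ (some k))
    rwa [hf] at this

end Cut

/-! ### Centrally large subalgebras of tensor products -/

section TensorCut

theorem norm_sum_fin_le {E : Type*} [SeminormedAddCommGroup E] {n : ℕ} {f : Fin n → E} {b : ℝ}
    (h : ∀ k, ‖f k‖ ≤ b) : ‖∑ k, f k‖ ≤ n * b := by
  refine (norm_sum_le_of_le _ fun k _ => h k).trans_eq ?_
  simp

variable {A₁ A₂ E : Type*} [CStarAlgebra A₁] [CStarAlgebra A₂] [CStarAlgebra E]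
  {ι₁ : A₁ →⋆ₐ[ℂ] E} {ι₂ : A₂ →⋆ₐ[ℂ] E}

/-- The cut-down elements in a tensor product are `g = 1 - (1 - g₁) ⊗ (1 - g₂)`, with `g₁` and `g₂`
obtained from the two factors. -/
theorem IsSlicedTensor.isCentrallyLarge [Nontrivial E] (hE : IsSlicedTensor ι₁ ι₂)
    (hdense : ∀ e : E, ∀ ε : ℝ, 0 < ε → ∃ (n : ℕ) (p : Fin n → A₁) (q : Fin n → A₂),
      ‖e - ∑ k, ι₁ (p k) * ι₂ (q k)‖ < ε)
    {B₁ : StarSubalgebra ℂ A₁} {B₂ : StarSubalgebra ℂ A₂} {F : StarSubalgebra ℂ E}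
    [IsClosed (B₁ : Set A₁)] [IsClosed (B₂ : Set A₂)] [hFc : IsClosed (F : Set E)]
    (hB₁ : IsCentrallyLarge B₁) (hB₂ : IsCentrallyLarge B₂)
    {κ₁ : B₁ →⋆ₐ[ℂ] F} {κ₂ : B₂ →⋆ₐ[ℂ] F} (hκ₁ : ∀ b, (κ₁ b : E) = ι₁ b)
    (hκ₂ : ∀ b, (κ₂ b : E) = ι₂ b) (hF : IsSlicedTensor κ₁ κ₂) (hfin : IsFiniteCStar E) :
    IsCentrallyLarge F := by
  have hs₁ := hB₁.simple
  have hs₂ := hB₂.simple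
  have hm₁ := hs₁.noMinimal hB₁.infinite
  have hm₂ := hs₂.noMinimal hB₂.infinite
  have hι₁ := hs₁.injective ι₁
  have hι₂ := hs₂.injective ι₂
  have hsE := hE.isSimpleCStar hs₁ hs₂
  have hinf : ¬ FiniteDimensional ℂ E := fun h =>
    hB₁.infinite (Module.Finite.of_injective ι₁.toAlgHom.toLinearMap hι₁)
  have hmE := hsE.noMinimal hinf
  have hfB₁ := hB₁.noMinimal (hfin.of_injective ι₁ hι₁)
  have hfB₂ := hB₂.noMinimal (hfin.of_injective ι₂ hι₂)
  refine ⟨hinf, hsE, hFc, fun m hm a ε hε x hx hx1 y hy hy0 => ?_⟩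
  obtain ⟨x₀, hx₀, hx₀0, hx₀x, hnorm⟩ := hfin.exists_forall_lt_norm hsE hmE hx hx1 hε
  obtain ⟨z₁, z₂, hz₁, hz₁0, hz₂, hz₂0, hz⟩ :=
    hE.exists_forall_cuntzSubequiv hs₁ hs₂ hm₁ hm₂ hx₀ hx₀0
  obtain ⟨w₁, w₂, hw₁, hw₁0, hw₂, hw₂0, hw⟩ := hF.exists_forall_cuntzSubequiv
    hB₁.isSimpleCStar hB₂.isSimpleCStar hfB₁ hfB₂ (StarSubalgebra.coe_nonneg_iff.mp hy) hy0
  choose n p q hpq using fun j => hdense (a j) (ε / 4) (by positivity)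
  -- a common bound `M` for the entries of the approximants and `N` for their lengths
  obtain ⟨M, hM1, hMp, hMq⟩ : ∃ M : ℝ, 1 ≤ M ∧ (∀ j k, ‖p j k‖ ≤ M) ∧ ∀ j k, ‖q j k‖ ≤ M := by
    refine ⟨1 + ∑ j, ∑ k, ‖p j k‖ + ∑ j, ∑ k, ‖q j k‖, ?_, fun j k => ?_, fun j k => ?_⟩
    · have h1 : 0 ≤ ∑ j, ∑ k, ‖p j k‖ := by positivity
      have h2 : 0 ≤ ∑ j, ∑ k, ‖q j k‖ := by positivity
      linarith
    · have h2 : 0 ≤ ∑ j, ∑ k, ‖q j k‖ := by positivity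
      have h3 : ‖p j k‖ ≤ ∑ k, ‖p j k‖ :=
        Finset.single_le_sum (f := fun k => ‖p j k‖) (fun _ _ => norm_nonneg _) (Finset.mem_univ k)
      have h4 : ∑ k, ‖p j k‖ ≤ ∑ j, ∑ k, ‖p j k‖ :=
        Finset.single_le_sum (f := fun j => ∑ k, ‖p j k‖) (fun _ _ => by positivity)
          (Finset.mem_univ j)
      linarith
    · have h2 : 0 ≤ ∑ j, ∑ k, ‖p j k‖ := by positivity
      have h3 : ‖q j k‖ ≤ ∑ k, ‖q j k‖ :=
        Finset.single_le_sum (f := fun k => ‖q j k‖) (fun _ _ => norm_nonneg _) (Finset.mem_univ k)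
      have h4 : ∑ k, ‖q j k‖ ≤ ∑ j, ∑ k, ‖q j k‖ :=
        Finset.single_le_sum (f := fun j => ∑ k, ‖q j k‖) (fun _ _ => by positivity)
          (Finset.mem_univ j)
      linarith
  obtain ⟨N, hN0, hN⟩ : ∃ N : ℝ, 0 < N ∧ ∀ j, (n j : ℝ) ≤ N := by
    refine ⟨1 + ∑ j, (n j : ℝ), by positivity, fun j => ?_⟩
    have : (n j : ℝ) ≤ ∑ j, (n j : ℝ) :=
      Finset.single_le_sum (f := fun j => (n j : ℝ)) (fun _ _ => by positivity) (Finset.mem_univ j)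
    linarith
  set δ : ℝ := min 1 (ε / (12 * M * N)) with hδ
  have hδ0 : 0 < δ := by positivity
  have hδ1 : δ ≤ 1 := min_le_left _ _
  have hδε : N * (3 * M * δ) ≤ ε / 4 := by
    have : δ ≤ ε / (12 * M * N) := min_le_right _ _
    calc N * (3 * M * δ) ≤ N * (3 * M * (ε / (12 * M * N))) := by gcongr
      _ = ε / 4 := by field_simp; norm_num
  obtain ⟨c₁, g₁, hg₁0, hg₁1, hc₁, hc₁B, hg₁w, hg₁z, hg₁c⟩ :=
    hB₁.exists_cut (fun jk : Σ j, Fin (n j) => p jk.1 jk.2) hδ0 hz₁ hz₁0 hw₁ hw₁0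
  obtain ⟨c₂, g₂, hg₂0, hg₂1, hc₂, hc₂B, hg₂w, hg₂z, hg₂c⟩ :=
    hB₂.exists_cut (fun jk : Σ j, Fin (n j) => q jk.1 jk.2) hδ0 hz₂ hz₂0 hw₂ hw₂0
  have hg₁0' : 0 ≤ (g₁ : A₁) := StarSubalgebra.coe_nonneg_iff.mpr hg₁0
  have hg₂0' : 0 ≤ (g₂ : A₂) := StarSubalgebra.coe_nonneg_iff.mpr hg₂0
  have hg₁1' : (g₁ : A₁) ≤ 1 := StarSubalgebra.coe_le_coe_iff.mpr hg₁1
  have hg₂1' : (g₂ : A₂) ≤ 1 := StarSubalgebra.coe_le_coe_iff.mpr hg₂1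
  have hn₁ := norm_one_sub_le_one hg₁0' hg₁1'
  have hn₂ := norm_one_sub_le_one hg₂0' hg₂1'
  set G : E := ι₁ (1 - g₁) * ι₂ (1 - g₂) with hG
  have hG0 : 0 ≤ G := tmul_nonneg hE.commute (sub_nonneg.mpr hg₁1') (sub_nonneg.mpr hg₂1')
  have hGn : ‖G‖ ≤ 1 := (norm_tmul_le _ _).trans (mul_le_one₀ hn₁ (norm_nonneg _) hn₂)
  have hG1 : G ≤ 1 := (CStarAlgebra.norm_le_one_iff_of_nonneg _ hG0).mp hGn
  set g : F := 1 - κ₁ (1 - g₁) * κ₂ (1 - g₂) with hg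
  have hgG : (g : E) = 1 - G := by
    rw [hg, hG]
    simp [hκ₁, hκ₂]
  have h1g : 1 - (g : E) = G := by rw [hgG, sub_sub_cancel]
  have hg0 : 0 ≤ (g : E) := by rw [hgG]; exact sub_nonneg.mpr hG1
  have hg1 : (g : E) ≤ 1 := by rw [hgG]; exact sub_le_self _ hG0
  have hgx₀ : CuntzSubequiv (g : E) x₀ := by rw [hgG]; exact hz _ _ hg₁1' hg₁z hg₂z
  -- the elementary tensors of the approximants are moved by at most `3 M δ`
  have hmove : ∀ j k, ‖ι₁ (c₁ ⟨j, k⟩) * ι₂ (c₂ ⟨j, k⟩) - ι₁ (p j k) * ι₂ (q j k)‖ ≤ 3 * M * δ := by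
    intro j k
    have e : ι₁ (c₁ ⟨j, k⟩) * ι₂ (c₂ ⟨j, k⟩) - ι₁ (p j k) * ι₂ (q j k)
        = ι₁ (c₁ ⟨j, k⟩ - p j k) * ι₂ (c₂ ⟨j, k⟩ - q j k) + ι₁ (c₁ ⟨j, k⟩ - p j k) * ι₂ (q j k)
          + ι₁ (p j k) * ι₂ (c₂ ⟨j, k⟩ - q j k) := by
      simp only [map_sub]; noncomm_ring
    have h1 := (hc₁ ⟨j, k⟩).le
    have h2 := (hc₂ ⟨j, k⟩).le
    rw [e]
    calc _ ≤ δ * 1 + δ * M + M * δ := by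
          refine (norm_add₃_le).trans ?_
          gcongr
          · exact (norm_tmul_le _ _).trans (by gcongr; exact h2.trans hδ1)
          · exact (norm_tmul_le _ _).trans (by gcongr; exact hMq j k)
          · exact (norm_tmul_le _ _).trans (by gcongr; exact hMp j k)
      _ ≤ 3 * M * δ := by nlinarith
  have hcomm : ∀ j k, ‖G * (ι₁ (p j k) * ι₂ (q j k)) - ι₁ (p j k) * ι₂ (q j k) * G‖
      ≤ 3 * M * δ := by
    intro j k
    have h1 : ‖(g₁ : A₁) * p j k - p j k * g₁‖ ≤ δ := (hg₁c ⟨j, k⟩).le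
    have h2 : ‖(g₂ : A₂) * q j k - q j k * g₂‖ ≤ δ := (hg₂c ⟨j, k⟩).le
    have e : G * (ι₁ (p j k) * ι₂ (q j k)) - ι₁ (p j k) * ι₂ (q j k) * G
        = - (ι₁ (g₁ * p j k - p j k * g₁) * ι₂ ((1 - g₂) * q j k))
          - ι₁ (p j k * (1 - g₁)) * ι₂ (g₂ * q j k - q j k * g₂) := by
      rw [hG, tmul_mul_tmul hE.commute, tmul_mul_tmul hE.commute]
      simp only [sub_mul, mul_sub, map_sub, map_mul, one_mul, mul_one]
      noncomm_ring
    rw [e]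
    calc _ ≤ δ * (1 * M) + (M * 1) * δ := by
          refine (norm_sub_le _ _).trans ?_
          rw [norm_neg]
          gcongr
          · refine (norm_tmul_le _ _).trans ?_
            gcongr
            exact (norm_mul_le _ _).trans (by gcongr; exact hMq j k)
          · refine (norm_tmul_le _ _).trans ?_
            gcongr
            exact (norm_mul_le _ _).trans (by gcongr; exact hMp j k)
      _ ≤ 3 * M * δ := by nlinarith
  have hsum : ∀ j, (n j : ℝ) * (3 * M * δ) ≤ ε / 4 := fun j =>
    (by gcongr; exact hN j : (n j : ℝ) * (3 * M * δ) ≤ N * (3 * M * δ)).trans hδε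
  refine ⟨fun j => ∑ k, ι₁ (c₁ ⟨j, k⟩) * ι₂ (c₂ ⟨j, k⟩), g, ⟨hg0, hg1⟩, fun j => ?_, fun j => ?_,
    ⟨hw _ _ hg₁1 hg₁w hg₂w, hgx₀.trans hx₀x⟩, hnorm g hg0 hg1 hgx₀, fun j => ?_⟩
  · have e : ∑ k, ι₁ (c₁ ⟨j, k⟩) * ι₂ (c₂ ⟨j, k⟩) - a j
        = ∑ k, (ι₁ (c₁ ⟨j, k⟩) * ι₂ (c₂ ⟨j, k⟩) - ι₁ (p j k) * ι₂ (q j k))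
          - (a j - ∑ k, ι₁ (p j k) * ι₂ (q j k)) := by
      rw [Finset.sum_sub_distrib]; abel
    rw [e]
    have h1 := (norm_sum_fin_le (hmove j)).trans (hsum j)
    have h2 := hpq j
    refine (norm_sub_le _ _).trans_lt ?_
    linarith
  · rw [h1g, Finset.mul_sum]
    refine sum_mem fun k _ => ?_
    rw [hG, tmul_mul_tmul hE.commute]
    have h1 : ι₁ ((1 - (g₁ : A₁)) * c₁ ⟨j, k⟩) ∈ F := by
      have := (κ₁ ⟨_, hc₁B ⟨j, k⟩⟩).2
      rwa [hκ₁] at this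
    have h2 : ι₂ ((1 - (g₂ : A₂)) * c₂ ⟨j, k⟩) ∈ F := by
      have := (κ₂ ⟨_, hc₂B ⟨j, k⟩⟩).2
      rwa [hκ₂] at this
    exact mul_mem h1 h2
  · set S := ∑ k, ι₁ (p j k) * ι₂ (q j k) with hS
    have e : (g : E) * a j - a j * (g : E)
        = (a j - S) * G - G * (a j - S) - ∑ k, (G * (ι₁ (p j k) * ι₂ (q j k))
          - ι₁ (p j k) * ι₂ (q j k) * G) := by
      rw [Finset.sum_sub_distrib, ← Finset.mul_sum, ← Finset.sum_mul, ← hS, hgG]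
      noncomm_ring
    rw [e]
    have h1 := (norm_sum_fin_le (hcomm j)).trans (hsum j)
    have h2 : ‖(a j - S) * G‖ ≤ ‖a j - S‖ * 1 := (norm_mul_le _ _).trans (by gcongr)
    have h3 : ‖G * (a j - S)‖ ≤ 1 * ‖a j - S‖ := (norm_mul_le _ _).trans (by gcongr)
    have h4 := hpq j
    have h5 := norm_sub_le ((a j - S) * G) (G * (a j - S))
    refine (norm_sub_le _ _).trans_lt ?_
    linarith

end TensorCut

/-! ### Excision of vector states -/

section VectorState

variable {D H : Type*} [CStarAlgebra D] [NormedAddCommGroup H] [InnerProductSpace ℂ H]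
  [CompleteSpace H]

theorem nonneg_of_forall_re_inner_nonneg (ρ : D →⋆ₐ[ℂ] (H →L[ℂ] H)) (hρ : Function.Injective ρ)
    {x : D} (hx : IsSelfAdjoint x) (h : ∀ ζ, 0 ≤ (⟪ρ x ζ, ζ⟫_ℂ).re) : 0 ≤ x := by
  have hρx : IsSelfAdjoint (ρ x) := hx.map ρ
  have hpos : (ρ x).IsPositive := ContinuousLinearMap.isPositive_def'.mpr ⟨hρx, h⟩
  rw [nonneg_iff_isSelfAdjoint_and_quasispectrumRestricts,
    quasispectrumRestricts_iff_spectrumRestricts, SpectrumRestricts.nnreal_iff,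
    ← hx.map_spectrum_real ρ hρ]
  exact ⟨hx, SpectrumRestricts.nnreal_iff.mp hpos.spectrumRestricts⟩

theorem inner_map_conj (ρ : D →⋆ₐ[ℂ] (H →L[ℂ] H)) (a x : D) (ζ : H) :
    ⟪ρ (star a * x * a) ζ, ζ⟫_ℂ = ⟪ρ x (ρ a ζ), ρ a ζ⟫_ℂ := by
  rw [map_mul, map_mul, map_star, ContinuousLinearMap.star_eq_adjoint]
  simp only [mul_apply_eq_comp]
  rw [ContinuousLinearMap.adjoint_inner_left]

theorem re_inner_map_nonneg (ρ : D →⋆ₐ[ℂ] (H →L[ℂ] H)) {x : D} (hx : 0 ≤ x) (ζ : H) :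
    0 ≤ (⟪ρ x ζ, ζ⟫_ℂ).re := by
  obtain ⟨s, rfl⟩ := CStarAlgebra.nonneg_iff_eq_star_mul_self.mp hx
  have := inner_map_conj ρ s 1 ζ
  rw [mul_one, map_one] at this
  rw [this]
  exact inner_self_nonneg (𝕜 := ℂ)

/-- The vector functional `x ↦ re ⟪ρ x ζ, ζ⟫`, which is real linear. -/
noncomputable def vectorFunctional (ρ : D →⋆ₐ[ℂ] (H →L[ℂ] H)) (ζ : H) : D →ₗ[ℝ] ℝ where
  toFun x := (⟪ρ x ζ, ζ⟫_ℂ).re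
  map_add' x y := by simp
  map_smul' r x := by
    have : ρ (r • x) = (r : ℂ) • ρ x := by rw [← Complex.coe_smul, map_smul]
    simp [this]

variable (ρ : D →⋆ₐ[ℂ] (H →L[ℂ] H))

theorem vectorFunctional_apply (ζ : H) (x : D) : vectorFunctional ρ ζ x = (⟪ρ x ζ, ζ⟫_ℂ).re := rfl

theorem vectorFunctional_nonneg {x : D} (hx : 0 ≤ x) (ζ : H) : 0 ≤ vectorFunctional ρ ζ x :=
  re_inner_map_nonneg ρ hx ζ

theorem vectorFunctional_one (ζ : H) : vectorFunctional ρ ζ 1 = ‖ζ‖ ^ 2 := by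
  rw [vectorFunctional_apply, map_one]
  exact inner_self_eq_norm_sq (𝕜 := ℂ) ζ

theorem vectorFunctional_conj {a : D} (ha : star a = a) (x : D) (ζ : H) :
    vectorFunctional ρ ζ (a * x * a) = vectorFunctional ρ (ρ a ζ) x := by
  have := inner_map_conj ρ a x ζ
  rw [ha] at this
  rw [vectorFunctional_apply, this, vectorFunctional_apply]

theorem vectorFunctional_smul_vec (r : ℝ) (ζ : H) (x : D) :
    vectorFunctional ρ ((r : ℂ) • ζ) x = r ^ 2 * vectorFunctional ρ ζ x := by
  simp only [vectorFunctional_apply, map_smul, inner_smul_left, inner_smul_right,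
    Complex.conj_ofReal]
  rw [← mul_assoc, ← Complex.ofReal_mul, Complex.re_ofReal_mul]
  ring

theorem abs_vectorFunctional_le (ζ : H) (x : D) : |vectorFunctional ρ ζ x| ≤ ‖x‖ * ‖ζ‖ ^ 2 := by
  calc _ ≤ ‖⟪ρ x ζ, ζ⟫_ℂ‖ := Complex.abs_re_le_norm _
    _ ≤ ‖ρ x ζ‖ * ‖ζ‖ := norm_inner_le_norm _ _
    _ ≤ (‖x‖ * ‖ζ‖) * ‖ζ‖ := by
        gcongr
        exact ((ρ x).le_opNorm ζ).trans
          (by gcongr; exact NonUnitalStarAlgHom.norm_apply_le ρ x)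
    _ = _ := by ring

/-- Excision of vector states, up to `ε`: finitely many self-adjoint `p k` are compressed by some
`a ≥ 0` to multiples `c k • a²`, where `∑ l k * c k` is almost as large as for a given unit vector.

Among the points of the joint numerical range of the `p k`, choose `c` almost maximizing
`∑ l k * c k + η * ‖c‖²`. By strict convexity, vector states with
value almost maximal at `h = ∑ (l k + 2 * η * c k) • p k` are close to `c`. Hence the part of `h`
at the top of its spectrum serves as `a`. -/
theorem exists_excision (hρ : Function.Injective ρ) {κ : Type*} [Fintype κ] {p : κ → D}
    (hp : ∀ k, IsSelfAdjoint (p k)) (l : κ → ℝ) {ξ₀ : H} (hξ₀ : ‖ξ₀‖ = 1) {ε : ℝ} (hε : 0 < ε) :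
    ∃ (a : D) (c : κ → ℝ), 0 ≤ a ∧ a ≠ 0 ∧
      ∑ k, l k * vectorFunctional ρ ξ₀ (p k) - ε ≤ ∑ k, l k * c k ∧ (∀ k, |c k| ≤ ‖p k‖) ∧
      ∀ k, 0 ≤ ε • (a * a) - (a * p k * a - c k • (a * a)) ∧
        0 ≤ ε • (a * a) + (a * p k * a - c k • (a * a)) := by
  set w : H → κ → ℝ := fun ξ k => vectorFunctional ρ ξ (p k) with hw
  have hwb : ∀ ξ, ‖ξ‖ = 1 → ∀ k, |w ξ k| ≤ ‖p k‖ := fun ξ hξ k => by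
    simpa [hξ] using abs_vectorFunctional_le ρ ξ (p k)
  set R := ∑ k, ‖p k‖ ^ 2 with hR
  have hR0 : 0 ≤ R := by positivity
  have hwR : ∀ ξ, ‖ξ‖ = 1 → ∑ k, w ξ k ^ 2 ≤ R := fun ξ hξ =>
    Finset.sum_le_sum fun k _ => sq_le_sq' (neg_le_of_abs_le (hwb ξ hξ k))
      (le_of_abs_le (hwb ξ hξ k))
  set η := ε / (2 * (R + 1)) with hη
  have hη0 : 0 < η := by positivity
  have hηR : η * R ≤ ε / 2 := by
    calc η * R ≤ η * (R + 1) := by gcongr; linarith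
      _ = ε / 2 := by rw [hη]; field_simp
  set τ := min (ε / 2) (η * ε ^ 2 / 2) with hτ
  have hτ0 : 0 < τ := by positivity
  set F : H → ℝ := fun ξ => ∑ k, l k * w ξ k + η * ∑ k, w ξ k ^ 2 with hF
  set U := F '' {ξ | ‖ξ‖ = 1}
  have hUne : U.Nonempty := ⟨F ξ₀, ξ₀, hξ₀, rfl⟩
  have hUbdd : BddAbove U := by
    refine ⟨∑ k, |l k| * ‖p k‖ + η * R, ?_⟩
    rintro _ ⟨ξ, hξ, rfl⟩
    refine add_le_add (Finset.sum_le_sum fun k _ => ?_)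
      (mul_le_mul_of_nonneg_left (hwR ξ hξ) hη0.le)
    refine (le_abs_self _).trans ?_
    rw [abs_mul]
    gcongr
    exact hwb ξ hξ k
  obtain ⟨_, ⟨ξ₁, hξ₁, rfl⟩, hsup⟩ := exists_lt_of_lt_csSup hUne (sub_lt_self (sSup U) hτ0)
  have hF₁ : ∀ ξ, ‖ξ‖ = 1 → F ξ ≤ F ξ₁ + τ := fun ξ hξ => by
    have := le_csSup hUbdd ⟨ξ, hξ, rfl⟩
    linarith
  set c := w ξ₁ with hc
  set h : D := ∑ k, (l k + 2 * η * c k) • p k with hh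
  have hhsa : IsSelfAdjoint h := isSelfAdjoint_sum _ fun k _ =>
    IsSelfAdjoint.smul (IsSelfAdjoint.all _) (hp k)
  have hhw : ∀ ξ, vectorFunctional ρ ξ h = ∑ k, (l k + 2 * η * c k) * w ξ k := fun ξ => by
    rw [hh, map_sum]
    simp only [map_smul, smul_eq_mul, hw]
  set t := vectorFunctional ρ ξ₁ h - τ with ht
  -- strict convexity: states nearly maximal at `h` are close to `c`
  have hclose : ∀ ξ, ‖ξ‖ = 1 → t ≤ vectorFunctional ρ ξ h → ∀ k, |w ξ k - c k| ≤ ε := by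
    intro ξ hξ hle k
    have e : F ξ - F ξ₁ = vectorFunctional ρ ξ h - vectorFunctional ρ ξ₁ h
        + η * ∑ k, (w ξ k - c k) ^ 2 := by
      rw [hhw, hhw, hF]
      simp only [Finset.mul_sum, ← Finset.sum_add_distrib, ← Finset.sum_sub_distrib]
      exact Finset.sum_congr rfl fun k _ => by ring
    have h1 : η * ∑ k, (w ξ k - c k) ^ 2 ≤ 2 * τ := by
      have := hF₁ ξ hξ
      linarith
    have h2 : (w ξ k - c k) ^ 2 ≤ ∑ k, (w ξ k - c k) ^ 2 :=
      Finset.single_le_sum (f := fun k => (w ξ k - c k) ^ 2) (fun _ _ => sq_nonneg _)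
        (Finset.mem_univ k)
    have h3 : η * (w ξ k - c k) ^ 2 ≤ η * ε ^ 2 := by
      have h4 : τ ≤ η * ε ^ 2 / 2 := min_le_right _ _
      have h5 := mul_le_mul_of_nonneg_left h2 hη0.le
      linarith
    have h4 := le_of_mul_le_mul_left h3 hη0
    exact abs_le_of_sq_le_sq h4 hε.le
  set k₀ : ℝ → ℝ := fun x => max 0 (x - t) with hk₀
  have hk₀c : Continuous k₀ := by fun_prop
  set a := cfc k₀ h with ha
  have ha0 : 0 ≤ a := cfc_nonneg fun x _ => le_max_left _ _
  have has : star a = a := (IsSelfAdjoint.of_nonneg ha0).star_eq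
  have hsub : h - algebraMap ℝ D t = cfc (fun x => x - t) h := by
    rw [cfc_sub (fun x => x) (fun _ => t) h, cfc_id' ℝ h, cfc_const t h]
  have htop : ∀ ζ, t * ‖ρ a ζ‖ ^ 2 ≤ vectorFunctional ρ (ρ a ζ) h := by
    intro ζ
    have h1 : 0 ≤ a * (h - algebraMap ℝ D t) * a := by
      rw [hsub, ha, ← cfc_mul k₀ (fun x => x - t) h, ← cfc_mul (fun x => k₀ x * (x - t)) k₀ h]
      refine cfc_nonneg fun x _ => ?_
      simp only [hk₀]
      rcases le_total (x - t) 0 with hx | hx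
      · simp [max_eq_left hx]
      · rw [max_eq_right hx]; positivity
    have h2 := vectorFunctional_nonneg ρ h1 ζ
    rw [vectorFunctional_conj ρ has, map_sub, Algebra.algebraMap_eq_smul_one, map_smul,
      vectorFunctional_one, smul_eq_mul] at h2
    linarith
  have hane : a ≠ 0 := by
    intro h0
    have hle : 0 ≤ algebraMap ℝ D t - h := by
      rw [← neg_sub, hsub, ← cfc_neg]
      refine cfc_nonneg fun x hx => ?_
      rw [ha, ← cfc_zero ℝ h, cfc_eq_cfc_iff_eqOn] at h0
      have h1 := h0 hx
      simp only [hk₀, Pi.zero_apply, max_eq_left_iff] at h1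
      linarith
    have h2 := vectorFunctional_nonneg ρ hle ξ₁
    rw [map_sub, Algebra.algebraMap_eq_smul_one, map_smul, vectorFunctional_one,
      (hξ₁ : ‖ξ₁‖ = 1), smul_eq_mul] at h2
    simp only [one_pow, mul_one, ht] at h2
    linarith
  have hbound : ∀ k ζ, |vectorFunctional ρ ζ (a * p k * a - c k • (a * a))|
      ≤ ε * vectorFunctional ρ ζ (a * a) := by
    intro k ζ
    have e1 : vectorFunctional ρ ζ (a * a) = ‖ρ a ζ‖ ^ 2 := by
      have := vectorFunctional_conj ρ has 1 ζ
      rwa [mul_one, vectorFunctional_one] at this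
    rw [map_sub, map_smul, e1, vectorFunctional_conj ρ has, smul_eq_mul]
    rcases eq_or_ne (ρ a ζ) 0 with h0 | h0
    · simp [h0, vectorFunctional_apply]
    set r := ‖ρ a ζ‖ with hr
    have hr0 : 0 < r := norm_pos_iff.mpr h0
    set ξ : H := ((r⁻¹ : ℝ) : ℂ) • ρ a ζ with hξ
    have hξ1 : ‖ξ‖ = 1 := by
      rw [hξ, norm_smul, Complex.norm_real, Real.norm_of_nonneg (by positivity), ← hr,
        inv_mul_cancel₀ hr0.ne']
    have e2 : ∀ x, vectorFunctional ρ (ρ a ζ) x = r ^ 2 * vectorFunctional ρ ξ x := fun x => by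
      rw [hξ, vectorFunctional_smul_vec]; field_simp
    have h1 := htop ζ
    rw [e2, mul_comm, ← hr] at h1
    have h2 := hclose ξ hξ1 (le_of_mul_le_mul_left h1 (by positivity)) k
    rw [e2]
    have e3 : r ^ 2 * vectorFunctional ρ ξ (p k) - c k * r ^ 2 = r ^ 2 * (w ξ k - c k) := by
      simp only [hw]; ring
    rw [e3, abs_mul, abs_of_nonneg (by positivity : 0 ≤ r ^ 2)]
    nlinarith [sq_nonneg r]
  have haa : IsSelfAdjoint (a * a) := by rw [IsSelfAdjoint, star_mul, has]
  have hapa : ∀ k, IsSelfAdjoint (a * p k * a - c k • (a * a)) := fun k => by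
    refine IsSelfAdjoint.sub ?_ (IsSelfAdjoint.smul (IsSelfAdjoint.all _) haa)
    rw [IsSelfAdjoint, star_mul, star_mul, has, (hp k).star_eq, mul_assoc]
  have hεaa : IsSelfAdjoint (ε • (a * a)) := IsSelfAdjoint.smul (IsSelfAdjoint.all _) haa
  refine ⟨a, c, ha0, hane, ?_, hwb ξ₁ hξ₁, fun k => ⟨?_, ?_⟩⟩
  · have h1 := le_csSup hUbdd ⟨ξ₀, hξ₀, rfl⟩
    have h2 : 0 ≤ η * ∑ k, w ξ₀ k ^ 2 := by positivity
    have h3 := mul_le_mul_of_nonneg_left (hwR ξ₁ hξ₁) hη0.le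
    have h4 : τ ≤ ε / 2 := min_le_left _ _
    simp only [hF] at h1 hsup
    linarith
  · refine nonneg_of_forall_re_inner_nonneg ρ hρ (hεaa.sub (hapa k)) fun ζ => ?_
    rw [← vectorFunctional_apply, map_sub, map_smul, smul_eq_mul, sub_nonneg]
    exact (le_abs_self _).trans (hbound k ζ)
  · refine nonneg_of_forall_re_inner_nonneg ρ hρ (hεaa.add (hapa k)) fun ζ => ?_
    rw [← vectorFunctional_apply, map_add, map_smul, smul_eq_mul]
    have := (neg_abs_le _).trans' (neg_le_neg (hbound k ζ))
    linarith

end VectorState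

/-! ### Kirchberg's slice lemma -/

section Slice

variable {D₁ D₂ E : Type*} [CStarAlgebra D₁] [CStarAlgebra D₂] [CStarAlgebra E]
  {ι₁ : D₁ →⋆ₐ[ℂ] E} {ι₂ : D₂ →⋆ₐ[ℂ] E}

theorem map_real_smul_starAlgHom (φ : D₁ →⋆ₐ[ℂ] E) (r : ℝ) (x : D₁) : φ (r • x) = r • φ x := by
  rw [← Complex.coe_smul, map_smul, Complex.coe_smul]

theorem exists_selfAdjoint_approx (hcomm : ∀ a b, Commute (ι₁ a) (ι₂ b))
    (hdense : ∀ e : E, ∀ ε : ℝ, 0 < ε → ∃ (n : ℕ) (p : Fin n → D₁) (q : Fin n → D₂),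
      ‖e - ∑ k, ι₁ (p k) * ι₂ (q k)‖ < ε)
    {e : E} (he : IsSelfAdjoint e) {δ : ℝ} (hδ : 0 < δ) :
    ∃ (n : ℕ) (p : Fin n ⊕ Fin n → D₁) (q : Fin n ⊕ Fin n → D₂),
      (∀ k, IsSelfAdjoint (p k)) ∧ (∀ k, IsSelfAdjoint (q k)) ∧
      ‖e - ∑ k, ι₁ (p k) * ι₂ (q k)‖ < δ := by
  obtain ⟨n, p, q, hpq⟩ := hdense e δ hδ
  set S := ∑ k, ι₁ (p k) * ι₂ (q k) with hS
  refine ⟨n, Sum.elim (fun k => (realPart (p k) : D₁)) fun k => -(imaginaryPart (p k) : D₁),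
    Sum.elim (fun k => (realPart (q k) : D₂)) fun k => (imaginaryPart (q k) : D₂), ?_, ?_, ?_⟩
  · rintro (k | k)
    · exact (realPart (p k)).2
    · exact (imaginaryPart (p k)).2.neg
  · rintro (k | k)
    · exact (realPart (q k)).2
    · exact (imaginaryPart (q k)).2
  have hterm : ∀ k, ι₁ (realPart (p k) : D₁) * ι₂ (realPart (q k) : D₂)
      - ι₁ (imaginaryPart (p k) : D₁) * ι₂ (imaginaryPart (q k) : D₂)
      = (1 / 2 : ℂ) • (ι₁ (p k) * ι₂ (q k) + star (ι₁ (p k) * ι₂ (q k))) := by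
    intro k
    have hp := realPart_add_I_smul_imaginaryPart (p k)
    have hq := realPart_add_I_smul_imaginaryPart (q k)
    have hp' : star (p k) = (realPart (p k) : D₁) - Complex.I • (imaginaryPart (p k) : D₁) := by
      nth_rewrite 1 [← hp]
      rw [star_add, star_smul, (realPart (p k)).2.star_eq, (imaginaryPart (p k)).2.star_eq]
      simp [sub_eq_add_neg]
    have hq' : star (q k) = (realPart (q k) : D₂) - Complex.I • (imaginaryPart (q k) : D₂) := by
      nth_rewrite 1 [← hq]
      rw [star_add, star_smul, (realPart (q k)).2.star_eq, (imaginaryPart (q k)).2.star_eq]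
      simp [sub_eq_add_neg]
    rw [star_tmul hcomm, hp', hq']
    nth_rewrite 3 [← hp]
    nth_rewrite 3 [← hq]
    simp only [map_add, map_sub, map_smul, add_mul, mul_add, sub_mul, mul_sub, smul_mul_assoc,
      mul_smul_comm]
    match_scalars <;> ring_nf
    simp [Complex.I_sq]
  have hsum : e - ∑ k : Fin n ⊕ Fin n,
      ι₁ (Sum.elim (fun k => (realPart (p k) : D₁)) (fun k => -(imaginaryPart (p k) : D₁)) k) *
      ι₂ (Sum.elim (fun k => (realPart (q k) : D₂)) (fun k => (imaginaryPart (q k) : D₂)) k)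
      = (1 / 2 : ℂ) • ((e - S) + star (e - S)) := by
    rw [Fintype.sum_sum_type]
    simp only [Sum.elim_inl, Sum.elim_inr, map_neg, neg_mul]
    rw [← Finset.sum_add_distrib]
    simp only [← sub_eq_add_neg, hterm]
    rw [← Finset.smul_sum, Finset.sum_add_distrib, ← star_sum, ← hS, star_sub, he.star_eq]
    module
  rw [hsum, norm_smul]
  have h1 := norm_add_le (e - S) (star (e - S))
  rw [norm_star] at h1
  have h2 : ‖(1 / 2 : ℂ)‖ = 1 / 2 := by norm_num
  rw [h2]
  linarith

/-- If `-x ≤ r ≤ x` and `-y ≤ s ≤ y`, then `- x ⊗ y ≤ r ⊗ s`. -/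
theorem tmul_add_tmul_nonneg (hcomm : ∀ a b, Commute (ι₁ a) (ι₂ b)) {x r : D₁} {y s : D₂}
    (h1 : 0 ≤ x - r) (h2 : 0 ≤ x + r) (h3 : 0 ≤ y - s) (h4 : 0 ≤ y + s) :
    0 ≤ ι₁ x * ι₂ y + ι₁ r * ι₂ s := by
  have h := add_nonneg (tmul_nonneg hcomm h1 h3) (tmul_nonneg hcomm h2 h4)
  have e : ι₁ x * ι₂ y + ι₁ r * ι₂ s = (1 / 2 : ℝ) • (ι₁ (x - r) * ι₂ (y - s)
      + ι₁ (x + r) * ι₂ (y + s)) := by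
    simp only [map_add, map_sub, add_mul, mul_add, sub_mul, mul_sub]
    module
  rw [e]
  exact smul_nonneg (by norm_num) h

theorem norm_smul_sq_add_conj_nonneg {D : Type*} [CStarAlgebra D] {b q : D} (hb : star b = b)
    (hq : IsSelfAdjoint q) : 0 ≤ ‖q‖ • (b * b) + b * q * b := by
  have h := star_left_conjugate_nonneg (neg_le_iff_add_nonneg'.mp
    (IsSelfAdjoint.neg_algebraMap_norm_le_self (a := q) hq)) b
  rw [hb] at h
  convert h using 1
  rw [mul_add, add_mul, Algebra.algebraMap_eq_smul_one]
  simp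

theorem mul_self_nonneg_and_ne_zero {D : Type*} [CStarAlgebra D] {x : D} (hx : star x = x)
    (hx0 : x ≠ 0) : 0 ≤ x * x ∧ x * x ≠ 0 := by
  have h1 := star_mul_self_nonneg x
  have h2 := CStarRing.star_mul_self_eq_zero_iff x
  rw [hx] at h1 h2
  exact ⟨h1, fun h => hx0 (h2.mp h)⟩

/-- Compressing an elementary tensor by `a ⊗ b`, where `a` and `b` approximately excise its
factors. -/
theorem tmul_excision (hcomm : ∀ a b, Commute (ι₁ a) (ι₂ b)) {a p : D₁} {b q : D₂}
    (ha : 0 ≤ a) (hb : 0 ≤ b) (hq : IsSelfAdjoint q) {c d ε : ℝ}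
    (hc₁ : 0 ≤ ε • (a * a) - (a * p * a - c • (a * a)))
    (hc₂ : 0 ≤ ε • (a * a) + (a * p * a - c • (a * a)))
    (hd₁ : 0 ≤ ε • (b * b) - (b * q * b - d • (b * b)))
    (hd₂ : 0 ≤ ε • (b * b) + (b * q * b - d • (b * b))) :
    0 ≤ ι₁ (a * p * a) * ι₂ (b * q * b) - (c * d - ε * (|c| + ‖q‖)) •
      (ι₁ (a * a) * ι₂ (b * b)) := by
  have has : star a = a := (IsSelfAdjoint.of_nonneg ha).star_eq
  have hbs : star b = b := (IsSelfAdjoint.of_nonneg hb).star_eq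
  have haa : 0 ≤ a * a := by
    have := star_mul_self_nonneg a
    rwa [has] at this
  have h1 : 0 ≤ ι₁ (ε • (a * a)) * ι₂ (‖q‖ • (b * b)) +
      ι₁ (a * p * a - c • (a * a)) * ι₂ (b * q * b) := by
    refine tmul_add_tmul_nonneg hcomm hc₁ hc₂ ?_ (norm_smul_sq_add_conj_nonneg hbs hq)
    have := norm_smul_sq_add_conj_nonneg hbs hq.neg
    rw [norm_neg] at this
    convert this using 1
    noncomm_ring
  have h2 : 0 ≤ ι₁ (|c| • (a * a)) * ι₂ (ε • (b * b)) +
      ι₁ (c • (a * a)) * ι₂ (b * q * b - d • (b * b)) := by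
    refine tmul_add_tmul_nonneg hcomm ?_ ?_ hd₁ hd₂
    · rw [← sub_smul]
      exact smul_nonneg (sub_nonneg.mpr (le_abs_self c)) haa
    · rw [← add_smul]
      exact smul_nonneg (by linarith [neg_abs_le c]) haa
  convert add_nonneg h1 h2 using 1
  simp only [map_sub, map_real_smul_starAlgHom, smul_mul_assoc, mul_smul_comm, sub_mul,
    mul_sub]
  module

variable {H₁ H₂ K : Type*} [NormedAddCommGroup H₁] [InnerProductSpace ℂ H₁] [CompleteSpace H₁]
  [NormedAddCommGroup H₂] [InnerProductSpace ℂ H₂] [CompleteSpace H₂]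
  [NormedAddCommGroup K] [InnerProductSpace ℂ K] [CompleteSpace K]

theorem vectorFunctional_tmul {ρ₁ : D₁ →⋆ₐ[ℂ] (H₁ →L[ℂ] H₁)} {ρ₂ : D₂ →⋆ₐ[ℂ] (H₂ →L[ℂ] H₂)}
    {Φ : E →⋆ₐ[ℂ] (K →L[ℂ] K)} {ξ : H₁} {η : H₂} {ζ : K}
    (h : ∀ a b, ⟪Φ (ι₁ a * ι₂ b) ζ, ζ⟫_ℂ = ⟪ρ₁ a ξ, ξ⟫_ℂ * ⟪ρ₂ b η, η⟫_ℂ) {a : D₁} {b : D₂}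
    (ha : IsSelfAdjoint a) :
    vectorFunctional Φ ζ (ι₁ a * ι₂ b) = vectorFunctional ρ₁ ξ a * vectorFunctional ρ₂ η b := by
  have him : (⟪ρ₁ a ξ, ξ⟫_ℂ).im = 0 := by
    have h1 : (starRingEnd ℂ) ⟪ρ₁ a ξ, ξ⟫_ℂ = ⟪ρ₁ a ξ, ξ⟫_ℂ := by
      rw [inner_conj_symm, ← ContinuousLinearMap.adjoint_inner_left,
        ← ContinuousLinearMap.star_eq_adjoint, (ha.map ρ₁).star_eq]
    exact Complex.conj_eq_iff_im.mp h1
  simp only [vectorFunctional_apply, h, Complex.mul_re, him, zero_mul, sub_zero]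

/-- **Kirchberg's slice lemma**. A product vector `T ξ η` detects `e`, and excising the vector
states of `ξ` and `η` gives `a ⊗ b` with `(a ⊗ b) e (a ⊗ b) ≥ r a² ⊗ b²` for some `r > 0`. -/
theorem exists_tmul_cuntzSubequiv (hcomm : ∀ a b, Commute (ι₁ a) (ι₂ b))
    (hdense : ∀ e : E, ∀ ε : ℝ, 0 < ε → ∃ (n : ℕ) (p : Fin n → D₁) (q : Fin n → D₂),
      ‖e - ∑ k, ι₁ (p k) * ι₂ (q k)‖ < ε)
    {ρ₁ : D₁ →⋆ₐ[ℂ] (H₁ →L[ℂ] H₁)} {ρ₂ : D₂ →⋆ₐ[ℂ] (H₂ →L[ℂ] H₂)} {Φ : E →⋆ₐ[ℂ] (K →L[ℂ] K)}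
    (hρ₁ : Function.Injective ρ₁) (hρ₂ : Function.Injective ρ₂) (hΦ : Function.Injective Φ)
    (T : H₁ →ₗ[ℂ] H₂ →ₗ[ℂ] K)
    (hT : ∀ a b ξ η, ⟪Φ (ι₁ a * ι₂ b) (T ξ η), T ξ η⟫_ℂ = ⟪ρ₁ a ξ, ξ⟫_ℂ * ⟪ρ₂ b η, η⟫_ℂ)
    (htot : ∀ S : K →L[ℂ] K, (∀ ξ η, S (T ξ η) = 0) → S = 0) {e : E} (he : 0 ≤ e) (he0 : e ≠ 0) :
    ∃ (a : D₁) (b : D₂), 0 ≤ a ∧ a ≠ 0 ∧ 0 ≤ b ∧ b ≠ 0 ∧ CuntzSubequiv (ι₁ a * ι₂ b) e := by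
  obtain ⟨ξ, η, hξ, hη, hpos⟩ : ∃ ξ η, ‖ξ‖ = 1 ∧ ‖η‖ = 1 ∧ 0 < vectorFunctional Φ (T ξ η) e := by
    obtain ⟨s, hs⟩ := CStarAlgebra.nonneg_iff_eq_star_mul_self.mp he
    have hs0 : s ≠ 0 := by rintro rfl; simp [hs] at he0
    have : ∃ ξ η, Φ s (T ξ η) ≠ 0 := by
      by_contra! hc
      exact hs0 (hΦ (by rw [map_zero]; exact htot _ hc))
    obtain ⟨ξ, η, hne⟩ := this
    have hξ : ξ ≠ 0 := by rintro rfl; simp at hne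
    have hη : η ≠ 0 := by rintro rfl; simp at hne
    have hξn := norm_ne_zero_iff.mpr hξ
    have hηn := norm_ne_zero_iff.mpr hη
    refine ⟨((‖ξ‖⁻¹ : ℝ) : ℂ) • ξ, ((‖η‖⁻¹ : ℝ) : ℂ) • η, ?_, ?_, ?_⟩
    · rw [norm_smul, Complex.norm_real, norm_inv, norm_norm, inv_mul_cancel₀ hξn]
    · rw [norm_smul, Complex.norm_real, norm_inv, norm_norm, inv_mul_cancel₀ hηn]
    · rw [map_smul, map_smul, LinearMap.smul_apply, vectorFunctional_smul_vec,
        vectorFunctional_smul_vec]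
      have h1 : vectorFunctional Φ (T ξ η) e = ‖Φ s (T ξ η)‖ ^ 2 := by
        have := inner_map_conj Φ s 1 (T ξ η)
        rw [mul_one, ← hs] at this
        rw [vectorFunctional_apply, this, ← vectorFunctional_one Φ, vectorFunctional_apply]
      have := norm_pos_iff.mpr hne
      rw [h1]
      positivity
  set ζ := T ξ η with hζ
  have hζ1 : ‖ζ‖ ^ 2 = 1 := by
    have h := vectorFunctional_tmul (fun a b => hT a b ξ η) (b := (1 : D₂)) (.one D₁)
    simpa only [map_one, mul_one, vectorFunctional_one, hξ, hη, one_pow] using h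
  set r := vectorFunctional Φ ζ e with hr
  have hesa : IsSelfAdjoint e := .of_nonneg he
  obtain ⟨n, p, q, hp, hq, hpq⟩ := exists_selfAdjoint_approx hcomm hdense hesa
    (show 0 < r / 8 by positivity)
  set S := ∑ k, ι₁ (p k) * ι₂ (q k) with hS
  have hSr : r - r / 8 ≤ ∑ k, vectorFunctional ρ₂ η (q k) * vectorFunctional ρ₁ ξ (p k) := by
    have h1 : vectorFunctional Φ ζ S
        = ∑ k, vectorFunctional ρ₂ η (q k) * vectorFunctional ρ₁ ξ (p k) := by
      rw [hS, map_sum]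
      refine Finset.sum_congr rfl fun k _ => ?_
      rw [vectorFunctional_tmul (fun a b => hT a b ξ η) (hp k), mul_comm]
    have h2 := abs_vectorFunctional_le Φ ζ (e - S)
    rw [hζ1, mul_one, map_sub, h1] at h2
    have h3 := (le_abs_self _).trans (h2.trans hpq.le)
    linarith
  set M := ∑ k, (‖p k‖ + ‖q k‖) with hM
  have hM0 : 0 ≤ M := by positivity
  set ε := r / (8 * (M + 1)) with hε
  have hε0 : 0 < ε := by positivity
  have hεr : ε * (M + 1) = r / 8 := by rw [hε]; field_simp
  obtain ⟨a, c, ha, ha0, hc, hcp, hac⟩ := exists_excision ρ₁ hρ₁ hp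
    (fun k => vectorFunctional ρ₂ η (q k)) hξ hε0
  obtain ⟨b, d, hb, hb0, hd, hdq, hbd⟩ := exists_excision ρ₂ hρ₂ hq c hη hε0
  have has : star a = a := (IsSelfAdjoint.of_nonneg ha).star_eq
  have hbs : star b = b := (IsSelfAdjoint.of_nonneg hb).star_eq
  set z := ι₁ a * ι₂ b with hz
  have hzs : star z = z := by rw [hz, star_tmul hcomm, has, hbs]
  set Z := ι₁ (a * a) * ι₂ (b * b) with hZ
  have hzz : z * z = Z := tmul_mul_tmul hcomm _ _ _ _
  have hZ0 : 0 ≤ Z := by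
    have := star_mul_self_nonneg z
    rwa [hzs, hzz] at this
  have hzSz : 0 ≤ z * S * z - (∑ k, (c k * d k - ε * (|c k| + ‖q k‖))) • Z := by
    have e1 : z * S * z - (∑ k, (c k * d k - ε * (|c k| + ‖q k‖))) • Z
        = ∑ k, (ι₁ (a * p k * a) * ι₂ (b * q k * b)
          - (c k * d k - ε * (|c k| + ‖q k‖)) • Z) := by
      rw [hS, Finset.mul_sum, Finset.sum_mul, Finset.sum_smul, ← Finset.sum_sub_distrib]
      simp only [hz, tmul_mul_tmul hcomm]
    rw [e1]
    exact Finset.sum_nonneg fun k _ => tmul_excision hcomm ha hb (hq k) (hac k).1 (hac k).2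
      (hbd k).1 (hbd k).2
  have hSsa : IsSelfAdjoint S := isSelfAdjoint_sum _ fun k _ => by
    rw [IsSelfAdjoint, star_tmul hcomm, (hp k).star_eq, (hq k).star_eq]
  have hzez : 0 ≤ z * (e - S) * z + (r / 8) • Z := by
    have h1 := norm_smul_sq_add_conj_nonneg hzs (hesa.sub hSsa)
    rw [hzz] at h1
    have h2 : 0 ≤ (r / 8 - ‖e - S‖) • Z := smul_nonneg (sub_nonneg.mpr hpq.le) hZ0
    convert add_nonneg h1 h2 using 1
    module
  have hcoef : r / 4 ≤ ∑ k, (c k * d k - ε * (|c k| + ‖q k‖)) - r / 8 := by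
    have h1 : ∑ k, ε * (|c k| + ‖q k‖) ≤ ε * M := by
      rw [← Finset.mul_sum, hM]
      gcongr with k
      exact hcp k
    have h2 : ∑ k, c k * vectorFunctional ρ₂ η (q k)
        = ∑ k, vectorFunctional ρ₂ η (q k) * c k := Finset.sum_congr rfl fun k _ => mul_comm _ _
    have h3 : ε * M + ε = r / 8 := by rw [← hεr]; ring
    have h4 : 0 ≤ ε * M := by positivity
    rw [Finset.sum_sub_distrib]
    linarith
  have hle : (r / 4) • Z ≤ z * e * z := by
    rw [← sub_nonneg]
    have h1 : 0 ≤ (∑ k, (c k * d k - ε * (|c k| + ‖q k‖)) - r / 8 - r / 4) • Z :=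
      smul_nonneg (sub_nonneg.mpr hcoef) hZ0
    have e1 : z * e * z = z * S * z + z * (e - S) * z := by noncomm_ring
    convert add_nonneg (add_nonneg hzSz hzez) h1 using 1
    rw [e1]
    module
  have hr4 : (0 : ℝ) < r / 4 := by positivity
  have hzez' : CuntzSubequiv (z * e * z) e := by
    have := cuntzSubequiv_conj z e
    rwa [hzs] at this
  have hZe : CuntzSubequiv Z e := by
    have h1 := (cuntzSubequiv_of_le (smul_nonneg hr4.le hZ0) hle).trans hzez'
    have h2 := (cuntzSubequiv_smul_self ((r / 4) • Z) (inv_pos.mpr hr4)).trans h1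
    rwa [smul_smul, inv_mul_cancel₀ hr4.ne', one_smul] at h2
  obtain ⟨haa, haa0⟩ := mul_self_nonneg_and_ne_zero has ha0
  obtain ⟨hbb, hbb0⟩ := mul_self_nonneg_and_ne_zero hbs hb0
  exact ⟨a * a, b * b, haa, haa0, hbb, hbb0, hZe⟩

end Slice

/-! ### Approximation by sums of elementary tensors -/

section ElementaryTensors

variable {D₁ D₂ E : Type*} [CStarAlgebra D₁] [CStarAlgebra D₂] [CStarAlgebra E]
  {ι₁ : D₁ →⋆ₐ[ℂ] E} {ι₂ : D₂ →⋆ₐ[ℂ] E}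

theorem exists_eq_sum_tmul_of_mem_adjoin (hcomm : ∀ a b, Commute (ι₁ a) (ι₂ b)) {e : E}
    (he : e ∈ StarAlgebra.adjoin ℂ {x | ∃ a b, x = ι₁ a * ι₂ b}) :
    ∃ (n : ℕ) (p : Fin n → D₁) (q : Fin n → D₂), e = ∑ k, ι₁ (p k) * ι₂ (q k) := by
  induction he using StarAlgebra.adjoin_induction with
  | mem x hx =>
    obtain ⟨a, b, rfl⟩ := hx
    exact ⟨1, fun _ => a, fun _ => b, by simp⟩
  | algebraMap r =>
    exact ⟨1, fun _ => algebraMap ℂ D₁ r, fun _ => 1, by simp [AlgHomClass.commutes]⟩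
  | add x y _ _ hx hy =>
    obtain ⟨n, p, q, rfl⟩ := hx
    obtain ⟨m, p', q', rfl⟩ := hy
    exact ⟨n + m, Fin.append p p', Fin.append q q', by simp [Fin.sum_univ_add]⟩
  | mul x y _ _ hx hy =>
    obtain ⟨n, p, q, rfl⟩ := hx
    obtain ⟨m, p', q', rfl⟩ := hy
    refine ⟨n * m, fun k => p (finProdFinEquiv.symm k).1 * p' (finProdFinEquiv.symm k).2,
      fun k => q (finProdFinEquiv.symm k).1 * q' (finProdFinEquiv.symm k).2, ?_⟩
    rw [finProdFinEquiv.symm.sum_comp fun k : Fin n × Fin m =>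
      ι₁ (p k.1 * p' k.2) * ι₂ (q k.1 * q' k.2), Fintype.sum_prod_type, Finset.sum_mul_sum]
    simp only [tmul_mul_tmul hcomm]
  | star x _ hx =>
    obtain ⟨n, p, q, rfl⟩ := hx
    exact ⟨n, fun k => star (p k), fun k => star (q k), by simp only [star_sum, star_tmul hcomm]⟩

theorem exists_norm_sub_sum_tmul_lt (hcomm : ∀ a b, Commute (ι₁ a) (ι₂ b)) {e : E}
    (he : e ∈ (StarAlgebra.adjoin ℂ {x | ∃ a b, x = ι₁ a * ι₂ b}).topologicalClosure) {ε : ℝ}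
    (hε : 0 < ε) :
    ∃ (n : ℕ) (p : Fin n → D₁) (q : Fin n → D₂), ‖e - ∑ k, ι₁ (p k) * ι₂ (q k)‖ < ε := by
  obtain ⟨f, hf, hef⟩ := Metric.mem_closure_iff.mp he ε hε
  obtain ⟨n, p, q, rfl⟩ := exists_eq_sum_tmul_of_mem_adjoin hcomm hf
  exact ⟨n, p, q, by rwa [← dist_eq_norm]⟩

end ElementaryTensors

/-! ### The minimal tensor product on Hilbert space -/

section Spatial

variable {H₁ H₂ : Type*} [NormedAddCommGroup H₁] [InnerProductSpace ℂ H₁]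
  [NormedAddCommGroup H₂] [InnerProductSpace ℂ H₂]

/-- The elementary tensor `ξ ⊗ η` in the Hilbert space tensor product, as a bilinear map. -/
noncomputable def pureTensor : H₁ →ₗ[ℂ] H₂ →ₗ[ℂ] HilbertTensor H₁ H₂ :=
  (TensorProduct.mk ℂ H₁ H₂).compr₂
    (UniformSpace.Completion.toComplL (𝕜 := ℂ) (E := H₁ ⊗[ℂ] H₂)).toLinearMap

theorem inner_pureTensor (ξ ξ' : H₁) (η η' : H₂) :
    ⟪pureTensor ξ η, pureTensor ξ' η'⟫_ℂ = ⟪ξ, ξ'⟫_ℂ * ⟪η, η'⟫_ℂ :=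
  (UniformSpace.Completion.inner_coe _ _).trans (TensorProduct.inner_tmul (𝕜 := ℂ) ξ ξ' η η')

theorem tensorOp_pureTensor [CompleteSpace H₁] [CompleteSpace H₂] (S : H₁ →L[ℂ] H₁)
    (T : H₂ →L[ℂ] H₂) (ξ : H₁) (η : H₂) :
    tensorOp S T (pureTensor ξ η) = pureTensor (S ξ) (T η) :=
  (TensorProduct.mapL S T).completion_apply_coe (ξ ⊗ₜ η)

theorem HilbertTensor.induction_on {p : HilbertTensor H₁ H₂ → Prop} (v : HilbertTensor H₁ H₂)
    (hp : IsClosed {v | p v}) (h0 : p 0) (hadd : ∀ v w, p v → p w → p (v + w))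
    (h : ∀ ξ η, p (pureTensor ξ η)) : p v := by
  refine UniformSpace.Completion.induction_on (p := p) v hp fun a => ?_
  induction a with
  | zero => exact h0
  | tmul ξ η => exact h ξ η
  | add x y hx hy =>
    rw [UniformSpace.Completion.coe_add]
    exact hadd _ _ hx hy

theorem eq_zero_of_forall_pureTensor {S : HilbertTensor H₁ H₂ →L[ℂ] HilbertTensor H₁ H₂}
    (h : ∀ ξ η, S (pureTensor ξ η) = 0) : S = 0 := by
  ext v
  refine HilbertTensor.induction_on v (isClosed_eq S.continuous continuous_const) (map_zero S)
    (fun v w hv hw => ?_) h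
  rw [map_add, hv, hw]
  simp

theorem eq_of_forall_pureTensor {S T : HilbertTensor H₁ H₂ →L[ℂ] HilbertTensor H₁ H₂}
    (h : ∀ ξ η, S (pureTensor ξ η) = T (pureTensor ξ η)) : S = T :=
  sub_eq_zero.mp (eq_zero_of_forall_pureTensor fun ξ η => by simp [h])

theorem eq_of_forall_inner_pureTensor {S T : HilbertTensor H₁ H₂ →L[ℂ] HilbertTensor H₁ H₂}
    (h : ∀ ξ η ξ' η', ⟪S (pureTensor ξ η), pureTensor ξ' η'⟫_ℂ
      = ⟪T (pureTensor ξ η), pureTensor ξ' η'⟫_ℂ) : S = T := by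
  refine eq_of_forall_pureTensor fun ξ η => ext_inner_right ℂ fun v => ?_
  refine HilbertTensor.induction_on (p := fun v => ⟪S (pureTensor ξ η), v⟫_ℂ
    = ⟪T (pureTensor ξ η), v⟫_ℂ) v ?_ ?_ (fun v w hv hw => ?_) (h ξ η)
  · exact isClosed_eq (innerSL ℂ _).continuous (innerSL ℂ _).continuous
  · rw [inner_zero_right, inner_zero_right]
  · rw [inner_add_right, hv, hw, inner_add_right]

variable [CompleteSpace H₁] [CompleteSpace H₂]

theorem tensorOp_mul (S S' : H₁ →L[ℂ] H₁) (T T' : H₂ →L[ℂ] H₂) :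
    tensorOp S T * tensorOp S' T' = tensorOp (S * S') (T * T') :=
  eq_of_forall_pureTensor fun ξ η => by simp [tensorOp_pureTensor]

theorem tensorOp_one : tensorOp (1 : H₁ →L[ℂ] H₁) (1 : H₂ →L[ℂ] H₂) = 1 :=
  eq_of_forall_pureTensor fun ξ η => by simp [tensorOp_pureTensor]

theorem star_tensorOp (S : H₁ →L[ℂ] H₁) (T : H₂ →L[ℂ] H₂) :
    star (tensorOp S T) = tensorOp (star S) (star T) :=
  eq_of_forall_inner_pureTensor fun ξ η ξ' η' => by
    simp only [ContinuousLinearMap.star_eq_adjoint, ContinuousLinearMap.adjoint_inner_left,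
      tensorOp_pureTensor, inner_pureTensor]

variable (H₁ H₂) in
/-- The representation `S ↦ S ⊗ 1` on the Hilbert space tensor product. -/
noncomputable def tensorLeft :
    (H₁ →L[ℂ] H₁) →⋆ₐ[ℂ] (HilbertTensor H₁ H₂ →L[ℂ] HilbertTensor H₁ H₂) where
  toFun S := tensorOp S 1
  map_one' := tensorOp_one
  map_mul' S S' := by rw [tensorOp_mul, mul_one]
  map_zero' := eq_of_forall_pureTensor fun ξ η => by simp [tensorOp_pureTensor]
  map_add' S S' := eq_of_forall_pureTensor fun ξ η => by simp [tensorOp_pureTensor]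
  commutes' r := eq_of_forall_pureTensor fun ξ η => by
    simp [tensorOp_pureTensor, Algebra.algebraMap_eq_smul_one]
  map_star' S := by rw [star_tensorOp, star_one]

variable (H₁ H₂) in
/-- The representation `T ↦ 1 ⊗ T` on the Hilbert space tensor product. -/
noncomputable def tensorRight :
    (H₂ →L[ℂ] H₂) →⋆ₐ[ℂ] (HilbertTensor H₁ H₂ →L[ℂ] HilbertTensor H₁ H₂) where
  toFun T := tensorOp 1 T
  map_one' := tensorOp_one
  map_mul' T T' := by rw [tensorOp_mul, mul_one]
  map_zero' := eq_of_forall_pureTensor fun ξ η => by simp [tensorOp_pureTensor]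
  map_add' T T' := eq_of_forall_pureTensor fun ξ η => by simp [tensorOp_pureTensor]
  commutes' r := eq_of_forall_pureTensor fun ξ η => by
    simp [tensorOp_pureTensor, Algebra.algebraMap_eq_smul_one]
  map_star' T := by rw [star_tensorOp, star_one]

theorem tensorLeft_mul_tensorRight (S : H₁ →L[ℂ] H₁) (T : H₂ →L[ℂ] H₂) :
    tensorLeft H₁ H₂ S * tensorRight H₁ H₂ T = tensorOp S T :=
  (tensorOp_mul S 1 1 T).trans (by rw [mul_one, one_mul])

theorem tensorRight_mul_tensorLeft (S : H₁ →L[ℂ] H₁) (T : H₂ →L[ℂ] H₂) :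
    tensorRight H₁ H₂ T * tensorLeft H₁ H₂ S = tensorOp S T :=
  (tensorOp_mul 1 S T 1).trans (by rw [mul_one, one_mul])

variable {A₁ A₂ : Type*} [CStarAlgebra A₁] [CStarAlgebra A₂]
  (π₁ : A₁ →⋆ₐ[ℂ] (H₁ →L[ℂ] H₁)) (π₂ : A₂ →⋆ₐ[ℂ] (H₂ →L[ℂ] H₂))

theorem tensorOp_mem_minTensor (a : A₁) (b : A₂) :
    tensorOp (π₁ a) (π₂ b) ∈ minTensor π₁ π₂ := (minTmul π₁ π₂ a b).2

/-- The embedding `a ↦ a ⊗ 1` of `A₁` into `A₁ ⊗_min A₂`. -/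
noncomputable def minLeft : A₁ →⋆ₐ[ℂ] minTensor π₁ π₂ :=
  ((tensorLeft H₁ H₂).comp π₁).codRestrict _ fun a => by
    have := tensorOp_mem_minTensor π₁ π₂ a 1
    rwa [map_one] at this

/-- The embedding `b ↦ 1 ⊗ b` of `A₂` into `A₁ ⊗_min A₂`. -/
noncomputable def minRight : A₂ →⋆ₐ[ℂ] minTensor π₁ π₂ :=
  ((tensorRight H₁ H₂).comp π₂).codRestrict _ fun b => by
    have := tensorOp_mem_minTensor π₁ π₂ 1 b
    rwa [map_one] at this

theorem minLeft_mul_minRight (a : A₁) (b : A₂) :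
    minLeft π₁ π₂ a * minRight π₁ π₂ b = minTmul π₁ π₂ a b :=
  Subtype.ext (tensorLeft_mul_tensorRight (π₁ a) (π₂ b))

theorem commute_minLeft_minRight (a : A₁) (b : A₂) :
    Commute (minLeft π₁ π₂ a) (minRight π₁ π₂ b) :=
  Subtype.ext ((tensorLeft_mul_tensorRight (π₁ a) (π₂ b)).trans
    (tensorRight_mul_tensorLeft (π₁ a) (π₂ b)).symm)

theorem exists_norm_sub_sum_minTmul_lt (e : minTensor π₁ π₂) (ε : ℝ) (hε : 0 < ε) :
    ∃ (n : ℕ) (p : Fin n → A₁) (q : Fin n → A₂),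
      ‖e - ∑ k, minLeft π₁ π₂ (p k) * minRight π₁ π₂ (q k)‖ < ε := by
  have hcomm : ∀ a b, Commute (((tensorLeft H₁ H₂).comp π₁) a) (((tensorRight H₁ H₂).comp π₂) b) :=
    fun a b => (tensorLeft_mul_tensorRight (π₁ a) (π₂ b)).trans
      (tensorRight_mul_tensorLeft (π₁ a) (π₂ b)).symm
  have he : (e : _ →L[ℂ] _) ∈ (StarAlgebra.adjoin ℂ
    {T | ∃ (a₁ : A₁) (a₂ : A₂), T = tensorOp (π₁ a₁) (π₂ a₂)}).topologicalClosure := e.2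
  obtain ⟨n, p, q, h⟩ := exists_norm_sub_sum_tmul_lt (e := (e : _ →L[ℂ] _)) hcomm
    (by simpa only [StarAlgHom.comp_apply, tensorLeft_mul_tensorRight] using he) hε
  refine ⟨n, p, q, ?_⟩
  change ‖((e - ∑ k, minLeft π₁ π₂ (p k) * minRight π₁ π₂ (q k) : minTensor π₁ π₂) :
    HilbertTensor H₁ H₂ →L[ℂ] HilbertTensor H₁ H₂)‖ < ε
  push_cast
  exact h

theorem inner_minTmul_pureTensor (a : A₁) (b : A₂) (ξ : H₁) (η : H₂) :
    ⟪(minTensor π₁ π₂).subtype (minLeft π₁ π₂ a * minRight π₁ π₂ b) (pureTensor ξ η),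
      pureTensor ξ η⟫_ℂ = ⟪π₁ a ξ, ξ⟫_ℂ * ⟪π₂ b η, η⟫_ℂ := by
  rw [minLeft_mul_minRight]
  change ⟪tensorOp (π₁ a) (π₂ b) (pureTensor ξ η), pureTensor ξ η⟫_ℂ = _
  rw [tensorOp_pureTensor, inner_pureTensor]

variable {π₁ π₂}

theorem isSlicedTensor_minTensor (hπ₁ : Function.Injective π₁) (hπ₂ : Function.Injective π₂) :
    IsSlicedTensor (minLeft π₁ π₂) (minRight π₁ π₂) where
  commute := commute_minLeft_minRight π₁ π₂
  slice _ he he0 := exists_tmul_cuntzSubequiv (commute_minLeft_minRight π₁ π₂)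
    (exists_norm_sub_sum_minTmul_lt π₁ π₂) hπ₁ hπ₂ (Φ := (minTensor π₁ π₂).subtype)
    Subtype.coe_injective pureTensor (inner_minTmul_pureTensor π₁ π₂)
    (fun _ => eq_zero_of_forall_pureTensor) he he0

theorem nontrivial_minTensor [Nontrivial A₁] [Nontrivial A₂] (hπ₁ : Function.Injective π₁)
    (hπ₂ : Function.Injective π₂) : Nontrivial (minTensor π₁ π₂) := by
  have h₁ : (1 : H₁ →L[ℂ] H₁) ≠ 0 := by
    rw [← map_one π₁, ← map_zero π₁]
    exact hπ₁.ne one_ne_zero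
  have h₂ : (1 : H₂ →L[ℂ] H₂) ≠ 0 := by
    rw [← map_one π₂, ← map_zero π₂]
    exact hπ₂.ne one_ne_zero
  obtain ⟨ξ, hξ⟩ := DFunLike.ne_iff.mp h₁
  obtain ⟨η, hη⟩ := DFunLike.ne_iff.mp h₂
  refine ⟨1, 0, fun h => ?_⟩
  have h0 : (1 : HilbertTensor H₁ H₂ →L[ℂ] HilbertTensor H₁ H₂) = 0 := congrArg Subtype.val h
  have h1 := inner_pureTensor ξ ξ η η
  have h2 : pureTensor ξ η = 0 := DFunLike.congr_fun h0 (pureTensor ξ η)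
  rw [h2, inner_zero_left, eq_comm, mul_eq_zero, inner_self_eq_zero, inner_self_eq_zero] at h1
  exact h1.elim hξ hη

variable (π₁ π₂) {B₁ : StarSubalgebra ℂ A₁} {B₂ : StarSubalgebra ℂ A₂}

variable (B₁ B₂) in
theorem minTmul_mem_minTensorSub {a : A₁} {b : A₂} (ha : a ∈ B₁) (hb : b ∈ B₂) :
    minTmul π₁ π₂ a b ∈ minTensorSub π₁ π₂ B₁ B₂ :=
  StarSubalgebra.le_topologicalClosure _ (StarAlgebra.subset_adjoin ℂ _ ⟨a, ha, b, hb, rfl⟩)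

variable (B₁ B₂) in
/-- The embedding `b ↦ b ⊗ 1` of `B₁` into `B₁ ⊗_min B₂`. -/
noncomputable def minSubLeft : B₁ →⋆ₐ[ℂ] minTensorSub π₁ π₂ B₁ B₂ :=
  ((minLeft π₁ π₂).comp B₁.subtype).codRestrict _ fun a => by
    have := minTmul_mem_minTensorSub π₁ π₂ B₁ B₂ a.2 (one_mem B₂)
    rwa [← minLeft_mul_minRight, map_one, mul_one] at this

variable (B₁ B₂) in
/-- The embedding `b ↦ 1 ⊗ b` of `B₂` into `B₁ ⊗_min B₂`. -/
noncomputable def minSubRight : B₂ →⋆ₐ[ℂ] minTensorSub π₁ π₂ B₁ B₂ :=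
  ((minRight π₁ π₂).comp B₂.subtype).codRestrict _ fun b => by
    have := minTmul_mem_minTensorSub π₁ π₂ B₁ B₂ (one_mem B₁) b.2
    rwa [← minLeft_mul_minRight, map_one, one_mul] at this

instance : IsClosed (minTensorSub π₁ π₂ B₁ B₂ : Set (minTensor π₁ π₂)) :=
  StarSubalgebra.isClosed_topologicalClosure _

theorem exists_norm_sub_sum_minTensorSub_lt [IsClosed (B₁ : Set A₁)] [IsClosed (B₂ : Set A₂)]
    (e : minTensorSub π₁ π₂ B₁ B₂) (ε : ℝ) (hε : 0 < ε) :
    ∃ (n : ℕ) (p : Fin n → B₁) (q : Fin n → B₂),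
      ‖e - ∑ k, minSubLeft π₁ π₂ B₁ B₂ (p k) * minSubRight π₁ π₂ B₁ B₂ (q k)‖ < ε := by
  have he : (e : minTensor π₁ π₂) ∈ (StarAlgebra.adjoin ℂ
    {t | ∃ b₁ ∈ B₁, ∃ b₂ ∈ B₂, t = minTmul π₁ π₂ b₁ b₂}).topologicalClosure := e.2
  have hset : {t | ∃ b₁ ∈ B₁, ∃ b₂ ∈ B₂, t = minTmul π₁ π₂ b₁ b₂} = {x | ∃ a b,
      x = ((minLeft π₁ π₂).comp B₁.subtype) a * ((minRight π₁ π₂).comp B₂.subtype) b} := by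
    ext t
    simp [minLeft_mul_minRight]
  rw [hset] at he
  obtain ⟨n, p, q, h⟩ := exists_norm_sub_sum_tmul_lt
    (ι₁ := (minLeft π₁ π₂).comp B₁.subtype) (ι₂ := (minRight π₁ π₂).comp B₂.subtype)
    (fun a b => commute_minLeft_minRight π₁ π₂ (a : A₁) (b : A₂)) he hε
  refine ⟨n, p, q, ?_⟩
  change ‖((e - ∑ k, minSubLeft π₁ π₂ B₁ B₂ (p k) * minSubRight π₁ π₂ B₁ B₂ (q k) :
    minTensorSub π₁ π₂ B₁ B₂) : minTensor π₁ π₂)‖ < ε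
  push_cast
  exact h

variable {π₁ π₂}

theorem isSlicedTensor_minTensorSub [IsClosed (B₁ : Set A₁)] [IsClosed (B₂ : Set A₂)]
    (hπ₁ : Function.Injective π₁) (hπ₂ : Function.Injective π₂) :
    IsSlicedTensor (minSubLeft π₁ π₂ B₁ B₂) (minSubRight π₁ π₂ B₁ B₂) := by
  have hcomm : ∀ a b, Commute (minSubLeft π₁ π₂ B₁ B₂ a) (minSubRight π₁ π₂ B₁ B₂ b) :=
    fun a b => Subtype.ext (commute_minLeft_minRight π₁ π₂ (a : A₁) (b : A₂))
  refine ⟨hcomm, fun _ he he0 => ?_⟩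
  exact exists_tmul_cuntzSubequiv hcomm (exists_norm_sub_sum_minTensorSub_lt π₁ π₂)
    (ρ₁ := π₁.comp B₁.subtype) (ρ₂ := π₂.comp B₂.subtype)
    (hπ₁.comp Subtype.coe_injective) (hπ₂.comp Subtype.coe_injective)
    (Φ := (minTensor π₁ π₂).subtype.comp (minTensorSub π₁ π₂ B₁ B₂).subtype)
    (Subtype.coe_injective.comp Subtype.coe_injective) pureTensor
    (fun a b => inner_minTmul_pureTensor π₁ π₂ (a : A₁) (b : A₂))
    (fun _ => eq_zero_of_forall_pureTensor) he he0

theorem isCentrallyLarge_minTensorSub (hB₁ : IsCentrallyLarge B₁) (hB₂ : IsCentrallyLarge B₂)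
    (hπ₁ : Function.Injective π₁) (hπ₂ : Function.Injective π₂)
    (hfin : IsFiniteCStar (minTensor π₁ π₂)) :
    IsCentrallyLarge (minTensorSub π₁ π₂ B₁ B₂) := by
  have := hB₁.closed
  have := hB₂.closed
  have := hB₁.simple.1
  have := hB₂.simple.1
  have := nontrivial_minTensor hπ₁ hπ₂
  exact (isSlicedTensor_minTensor hπ₁ hπ₂).isCentrallyLarge (exists_norm_sub_sum_minTmul_lt π₁ π₂)
    hB₁ hB₂ (fun _ => rfl) (fun _ => rfl) (isSlicedTensor_minTensorSub hπ₁ hπ₂) hfin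

end Spatial

/-! ### Comparison by matrix units -/

section MatrixUnits

variable {D E : Type*} [CStarAlgebra D] [CStarAlgebra E] {n : ℕ}

/-- A copy `δ` of `D` in `E` together with `n × n` matrix units `e i j` commuting with it, such that
every nonzero `y ≥ 0` in `E` has a nonzero diagonal entry `a ≥ 0`, in the sense that
`e i i * y * e i i = δ a * e i i`. -/
structure IsMatrixSystem (δ : D →⋆ₐ[ℂ] E) (e : Fin n → Fin n → E) : Prop where
  mul : ∀ i j k l, e i j * e k l = if j = k then e i l else 0
  star_eq : ∀ i j, star (e i j) = e j i
  sum : ∑ i, e i i = 1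
  commute : ∀ a i j, Commute (δ a) (e i j)
  corner : ∀ y, 0 ≤ y → y ≠ 0 → ∃ i a, 0 ≤ a ∧ a ≠ 0 ∧ e i i * y * e i i = δ a * e i i

theorem IsMatrixSystem.norm_le_one {δ : D →⋆ₐ[ℂ] E} {e : Fin n → Fin n → E}
    (h : IsMatrixSystem δ e) (i j : Fin n) : ‖e i j‖ ≤ 1 := by
  have h1 := CStarRing.norm_star_mul_self (x := e i j)
  have h2 := CStarRing.norm_star_mul_self (x := e j j)
  rw [h.star_eq, h.mul, if_pos rfl] at h1 h2
  have h3 : ‖e j j‖ ≤ 1 := by nlinarith [norm_nonneg (e j j)]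
  nlinarith [norm_nonneg (e i j)]

/-- Every nonzero `y ≥ 0` leaves room for the diagonal matrices `δ g` with `g` small: a diagonal
entry of `y` dominates `n` orthogonal copies of some `z`, which the matrix units spread out along
the diagonal. -/
theorem IsMatrixSystem.exists_forall_cuntzSubequiv {δ : D →⋆ₐ[ℂ] E} {e : Fin n → Fin n → E}
    (h : IsMatrixSystem δ e) (hD : IsSimpleCStar D) (hm : NoMinimal D) {y : E} (hy : 0 ≤ y)
    (hy0 : y ≠ 0) :
    ∃ z, 0 ≤ z ∧ z ≠ 0 ∧ ∀ g, CuntzSubequiv g z → CuntzSubequiv (δ g) y := by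
  obtain ⟨i₀, a, ha, ha0, hcorner⟩ := h.corner y hy hy0
  obtain ⟨hq, hq0, hqa⟩ := sqrt_spec ha ha0
  obtain ⟨t, z, hz, hz0, htz⟩ := IsSimpleCStar.exists_orthogonal_copies hD hm hq hq0 n
  simp only [hqa] at htz
  refine ⟨z, hz, hz0, fun g hg => (hg.map δ).trans ?_⟩
  set W := ∑ i : Fin n, δ (star (t i.castSucc)) * e i i₀ with hW
  have hWs : star W = ∑ i : Fin n, e i₀ i * δ (t i.castSucc) := by
    simp only [hW, star_sum, star_mul, h.star_eq, ← map_star, star_star]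
  have key : W * (e i₀ i₀ * y * e i₀ i₀) * star W = δ z := by
    rw [hcorner, hWs, hW, Finset.sum_mul, Finset.sum_mul]
    simp only [Finset.mul_sum]
    have hterm : ∀ i j : Fin n, δ (star (t i.castSucc)) * e i i₀ * (δ a * e i₀ i₀) *
        (e i₀ j * δ (t j.castSucc)) = if i = j then δ z * e i j else 0 := by
      intro i j
      calc _ = δ (star (t i.castSucc)) * (e i i₀ * δ a) * (e i₀ i₀ * e i₀ j) *
            δ (t j.castSucc) := by
            noncomm_ring
        _ = δ (star (t i.castSucc)) * δ a * (e i i₀ * e i₀ j * δ (t j.castSucc)) := by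
            rw [← (h.commute a i i₀).eq, h.mul i₀ i₀ i₀ j, if_pos rfl]
            noncomm_ring
        _ = δ (star (t i.castSucc) * a * t j.castSucc) * e i j := by
            rw [h.mul i i₀ i₀ j, if_pos rfl, ← (h.commute _ i j).eq]
            simp only [map_mul, mul_assoc]
        _ = _ := by
            rw [htz]
            simp only [Fin.castSucc_inj]
            split_ifs <;> simp
    simp only [hterm, Finset.sum_ite_eq, Finset.mem_univ, if_true]
    rw [← Finset.mul_sum, h.sum, mul_one]
  have h1 := cuntzSubequiv_conj W (e i₀ i₀ * y * e i₀ i₀)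
  have h2 := cuntzSubequiv_conj (e i₀ i₀) y
  rw [h.star_eq] at h2
  rw [key] at h1
  exact h1.trans h2

end MatrixUnits

/-! ### Matrix algebras -/

theorem exists_eq_star_mul_self {D : Type*} [CStarAlgebra D] {y : D} (hy : 0 ≤ y) :
    ∃ s, y = star s * s :=
  CStarAlgebra.nonneg_iff_eq_star_mul_self.mp hy

namespace CStarMatrix

variable {A : Type*} [CStarAlgebra A] {n : ℕ}

/-- The matrix unit with entry `1` at `(i, j)`. -/
def unit (i j : Fin n) : CStarMatrix (Fin n) (Fin n) A := ofMatrix (Matrix.single i j 1)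

theorem unit_apply (i j k l : Fin n) :
    (unit i j : CStarMatrix (Fin n) (Fin n) A) k l = if i = k ∧ j = l then 1 else 0 := rfl

variable (n A) in
/-- The embedding of `A` into `M_n(A)` as the scalar matrices `diag(a, …, a)`. -/
noncomputable def scalarHom : A →⋆ₐ[ℂ] CStarMatrix (Fin n) (Fin n) A where
  toFun a := ofMatrix (Matrix.diagonal fun _ => a)
  map_one' := congrArg ofMatrix Matrix.diagonal_one
  map_mul' a b := congrArg ofMatrix (Matrix.diagonal_mul_diagonal _ _).symm
  map_zero' := congrArg ofMatrix Matrix.diagonal_zero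
  map_add' a b := congrArg ofMatrix (Matrix.diagonal_add _ _).symm
  commutes' r := by
    ext i j
    simp [Matrix.diagonal_apply, CStarMatrix.algebraMap_apply]
  map_star' a := by
    ext i j
    rw [star_apply, ofMatrix_apply, ofMatrix_apply, Matrix.diagonal_apply, Matrix.diagonal_apply]
    split_ifs with h1 h2 h2
    exacts [rfl, absurd h1.symm h2, absurd h2.symm h1, (star_zero A).symm]

theorem scalarHom_apply (a : A) (i j : Fin n) : scalarHom A n a i j = if i = j then a else 0 :=
  rfl

theorem scalarHom_mul_apply (a : A) (M : CStarMatrix (Fin n) (Fin n) A) (i j : Fin n) :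
    (scalarHom A n a * M) i j = a * M i j := by
  simp [mul_apply, scalarHom_apply]

theorem mul_scalarHom_apply (a : A) (M : CStarMatrix (Fin n) (Fin n) A) (i j : Fin n) :
    (M * scalarHom A n a) i j = M i j * a := by
  simp [mul_apply, scalarHom_apply]

theorem sum_scalarHom_mul_unit (M : CStarMatrix (Fin n) (Fin n) A) :
    ∑ i, ∑ j, scalarHom A n (M i j) * unit i j = M := by
  ext k l
  have h : ∀ (s : Finset (Fin n)) (f : Fin n → CStarMatrix (Fin n) (Fin n) A),
      (∑ i ∈ s, f i) k l = ∑ i ∈ s, f i k l := fun s f =>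
    map_sum (⟨⟨fun M : CStarMatrix (Fin n) (Fin n) A => M k l, rfl⟩, fun _ _ => rfl⟩ :
      CStarMatrix (Fin n) (Fin n) A →+ A) f s
  simp [h, scalarHom_mul_apply, unit_apply, ite_and]

theorem unit_mul_mul_unit (M : CStarMatrix (Fin n) (Fin n) A) (i j k l : Fin n) :
    unit i j * M * unit k l = scalarHom A n (M j k) * unit i l := by
  ext p q
  rw [scalarHom_mul_apply]
  simp only [mul_apply, unit_apply, ite_and, ite_mul, one_mul, zero_mul, mul_ite, mul_one, mul_zero,
    Finset.sum_ite_eq, Finset.mem_univ, if_true]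
  split_ifs <;> simp

theorem exists_diagonal_entry {y : CStarMatrix (Fin n) (Fin n) A} (hy : 0 ≤ y) (hy0 : y ≠ 0) :
    ∃ i, 0 ≤ y i i ∧ y i i ≠ 0 := by
  obtain ⟨s, rfl⟩ := exists_eq_star_mul_self hy
  have he : ∀ i, (star s * s) i i = ∑ k, star (s k i) * s k i := fun i => by
    simp only [mul_apply, star_apply]
  have hs : ∃ k i, s k i ≠ 0 := by
    by_contra! hc
    exact hy0 (by rw [show s = 0 from CStarMatrix.ext hc, mul_zero])
  obtain ⟨k, i, hki⟩ := hs
  have hnn : ∀ k ∈ Finset.univ, 0 ≤ star (s k i) * s k i := fun k _ => star_mul_self_nonneg _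
  refine ⟨i, by rw [he]; exact Finset.sum_nonneg hnn, fun h0 => hki ?_⟩
  rw [he, Finset.sum_eq_zero_iff_of_nonneg hnn] at h0
  exact (CStarRing.star_mul_self_eq_zero_iff _).mp (h0 k (Finset.mem_univ k))

theorem isMatrixSystem : IsMatrixSystem (scalarHom A n) unit where
  mul i j k l := by
    ext p q
    by_cases h : j = k
    · simp [mul_apply, unit_apply, ite_and, h]
      split_ifs <;> rfl
    · simp [mul_apply, unit_apply, ite_and, h]
  star_eq i j := by
    ext p q
    simp only [star_apply, unit_apply, and_comm (a := j = p)]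
    split_ifs <;> simp
  sum := by
    have := sum_scalarHom_mul_unit (1 : CStarMatrix (Fin n) (Fin n) A)
    simpa [one_apply, ite_and, apply_ite (scalarHom A n)] using this
  commute a i j := by
    ext p q
    rw [scalarHom_mul_apply, mul_scalarHom_apply, unit_apply]
    split_ifs <;> simp
  corner y hy hy0 := by
    obtain ⟨i, hi, hi0⟩ := exists_diagonal_entry hy hy0
    exact ⟨i, y i i, hi, hi0, unit_mul_mul_unit y i i i i⟩

theorem norm_le_of_forall_entry {M : CStarMatrix (Fin n) (Fin n) A} {δ : ℝ}
    (h : ∀ i j, ‖M i j‖ ≤ δ) : ‖M‖ ≤ n * (n * δ) := by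
  rw [← sum_scalarHom_mul_unit M]
  refine norm_sum_fin_le fun i => norm_sum_fin_le fun j => (norm_mul_le _ _).trans ?_
  have h1 := NonUnitalStarAlgHom.norm_apply_le (scalarHom A n) (M i j)
  have h2 := isMatrixSystem.norm_le_one (D := A) i j
  have h3 := h i j
  nlinarith [norm_nonneg (M i j), norm_nonneg (scalarHom A n (M i j))]

theorem isSimpleCStar [Nonempty (Fin n)] (hA : IsSimpleCStar A) :
    IsSimpleCStar (CStarMatrix (Fin n) (Fin n) A) := by
  have := hA.1
  refine ⟨inferInstance, fun I hI => ?_⟩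
  by_contra! hc
  obtain ⟨M, hM, hM0⟩ := TwoSidedIdeal.exists_ne_zero_of_ne_bot hc.1
  obtain ⟨i, j, hij⟩ : ∃ i j, M i j ≠ 0 := by
    by_contra! h
    exact hM0 (CStarMatrix.ext h)
  obtain ⟨m, x, y, hxy⟩ := hA.exists_sum_mul_mul_eq_one hij
  have hk : ∀ k, unit k k ∈ I := by
    intro k
    have e : (unit k k : CStarMatrix (Fin n) (Fin n) A)
        = ∑ r, scalarHom A n (x r) * (unit k i * M * unit j k) * scalarHom A n (y r) := by
      ext p q
      simp only [unit_mul_mul_unit]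
      have h : ∀ r, scalarHom A n (x r) * (scalarHom A n (M i j) * unit k k) * scalarHom A n (y r)
          = scalarHom A n (x r * M i j * y r) * unit k k := by
        intro r
        rw [mul_assoc, mul_assoc, ← (isMatrixSystem.commute (y r) k k).eq]
        simp only [map_mul, mul_assoc]
      simp only [h]
      rw [← Finset.sum_mul, ← map_sum, hxy, map_one, one_mul]
    rw [e]
    exact sum_mem fun r _ => I.mul_mem_right _ _
      (I.mul_mem_left _ _ (I.mul_mem_right _ _ (I.mul_mem_left _ _ hM)))
  apply hc.2
  rw [← TwoSidedIdeal.one_mem_iff, ← isMatrixSystem.sum]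
  exact sum_mem fun k _ => hk k

end CStarMatrix

/-! ### Centrally large subalgebras of matrix algebras -/

section MatrixSubalgebra

open CStarMatrix

variable {A : Type*} [CStarAlgebra A] {n : ℕ} (B : StarSubalgebra ℂ A)

theorem scalarHom_mem_matrixSubalgebra {a : A} (ha : a ∈ B) :
    scalarHom A n a ∈ matrixSubalgebra n B := by
  intro i j
  rw [scalarHom_apply]
  split_ifs
  exacts [ha, zero_mem B]

theorem unit_mem_matrixSubalgebra (i j : Fin n) : unit i j ∈ matrixSubalgebra n B := by
  intro k l
  rw [unit_apply]
  split_ifs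
  exacts [one_mem B, zero_mem B]

theorem isClosed_matrixSubalgebra [IsClosed (B : Set A)] :
    IsClosed (matrixSubalgebra n B : Set (CStarMatrix (Fin n) (Fin n) A)) := by
  have h : (matrixSubalgebra n B : Set (CStarMatrix (Fin n) (Fin n) A))
      = ⋂ i, ⋂ j, {M | M i j ∈ (B : Set A)} := by
    ext M
    simp only [Set.mem_iInter]
    rfl
  rw [h]
  refine isClosed_iInter fun i => isClosed_iInter fun j => ?_
  have hc : Continuous fun M : CStarMatrix (Fin n) (Fin n) A => M i j :=
    (continuous_apply j).comp (continuous_apply i)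
  exact IsClosed.preimage hc ‹IsClosed (B : Set A)›

instance [IsClosed (B : Set A)] :
    IsClosed (matrixSubalgebra n B : Set (CStarMatrix (Fin n) (Fin n) A)) :=
  isClosed_matrixSubalgebra B

variable (n) in
/-- The embedding of `B` into `M_n(B)` as the scalar matrices `diag(b, …, b)`. -/
noncomputable def scalarSubHom : B →⋆ₐ[ℂ] matrixSubalgebra n B :=
  ((scalarHom A n).comp B.subtype).codRestrict _ fun b => scalarHom_mem_matrixSubalgebra B b.2

theorem isMatrixSystem_matrixSubalgebra [IsClosed (B : Set A)] :
    IsMatrixSystem (scalarSubHom n B)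
      fun i j => (⟨unit i j, unit_mem_matrixSubalgebra B i j⟩ : matrixSubalgebra n B) where
  mul i j k l := by
    refine Subtype.ext ((isMatrixSystem.mul i j k l).trans ?_)
    split_ifs <;> rfl
  star_eq i j := Subtype.ext (isMatrixSystem.star_eq i j)
  sum := Subtype.ext ((AddSubmonoidClass.coe_finsetSum _ _).trans isMatrixSystem.sum)
  commute a i j := Subtype.ext (isMatrixSystem.commute (a : A) i j)
  corner y hy hy0 := by
    obtain ⟨i, hi, hi0⟩ := exists_diagonal_entry (StarSubalgebra.coe_nonneg_iff.mpr hy)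
      (fun h => hy0 (Subtype.ext h))
    refine ⟨i, ⟨(y : CStarMatrix (Fin n) (Fin n) A) i i, y.2 i i⟩,
      StarSubalgebra.coe_nonneg_iff.mp hi, fun h => hi0 (congrArg Subtype.val h), ?_⟩
    exact Subtype.ext (unit_mul_mul_unit (y : CStarMatrix (Fin n) (Fin n) A) i i i i)

variable {B}

/-- The cut-down elements in `M_n(A)` are `diag(g, …, g)`, where `g` serves all matrix entries at
once. -/
theorem IsCentrallyLarge.matrixSubalgebra (hB : IsCentrallyLarge B)
    (hfin : IsStablyFiniteCStar A) (hn : 0 < n) : IsCentrallyLarge (matrixSubalgebra n B) := by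
  have := hB.closed
  have : Nonempty (Fin n) := ⟨⟨0, hn⟩⟩
  have := hB.simple.1
  have hscalar : Function.Injective (scalarHom A n) := hB.simple.injective _
  have hfinA : IsFiniteCStar A := (hfin n hn).of_injective _ hscalar
  have hinf : ¬ FiniteDimensional ℂ (CStarMatrix (Fin n) (Fin n) A) := fun h =>
    hB.infinite (FiniteDimensional.of_injective (scalarHom A n).toAlgHom.toLinearMap hscalar)
  have hsimple := CStarMatrix.isSimpleCStar (n := n) hB.simple
  refine ⟨hinf, hsimple, isClosed_matrixSubalgebra B, ?_⟩
  intro m hm a ε hε x hx hx1 y hy hy0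
  obtain ⟨x₀, hx₀, hx₀0, hx₀x, hnorm⟩ := (hfin n hn).exists_forall_lt_norm hsimple
    (hsimple.noMinimal hinf) hx hx1 hε
  obtain ⟨z, hz, hz0, hzx⟩ := isMatrixSystem.exists_forall_cuntzSubequiv hB.simple
    (hB.simple.noMinimal hB.infinite) hx₀ hx₀0
  obtain ⟨w, hw, hw0, hwy⟩ := (isMatrixSystem_matrixSubalgebra B).exists_forall_cuntzSubequiv
    hB.isSimpleCStar (hB.noMinimal hfinA) (StarSubalgebra.coe_nonneg_iff.mp hy) hy0
  set δ := ε / (n * n + 1) with hδ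
  have hδ0 : 0 < δ := by positivity
  have hδε : n * (n * δ) < ε := by
    have : δ * (n * n + 1) = ε := by rw [hδ]; field_simp
    linarith
  obtain ⟨c, g, hg, hg1, hca, hcB, hgw, hgz, hcomm⟩ :=
    hB.exists_cut (κ := Fin m × Fin n × Fin n) (fun k => a k.1 k.2.1 k.2.2) hδ0 hz hz0 hw hw0
  have hg' : 0 ≤ (g : A) := StarSubalgebra.coe_nonneg_iff.mpr hg
  have hg1' : (g : A) ≤ 1 := StarSubalgebra.coe_le_coe_iff.mpr hg1
  have hG : ((scalarSubHom n B g : _root_.matrixSubalgebra n B) :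
      CStarMatrix (Fin n) (Fin n) A) = scalarHom A n g := rfl
  have h1G : 1 - scalarHom A n (g : A) = scalarHom A n (1 - g) := by rw [map_sub, map_one]
  have hG0 : 0 ≤ scalarHom A n (g : A) := map_nonneg_starAlgHom _ hg'
  have hG1 : scalarHom A n (g : A) ≤ 1 := by
    rw [← sub_nonneg, h1G]
    exact map_nonneg_starAlgHom _ (sub_nonneg.mpr hg1')
  have hGx₀ := hzx g hgz
  refine ⟨fun j => ofMatrix fun p q => c (j, p, q), scalarSubHom n B g, ?_⟩
  rw [hG]
  refine ⟨⟨hG0, hG1⟩, fun j => ?_, fun j => ?_, ⟨hwy g hgw, hGx₀.trans hx₀x⟩,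
    hnorm _ hG0 hG1 hGx₀, fun j => ?_⟩
  · exact (norm_le_of_forall_entry fun p q => (hca (j, p, q)).le).trans_lt hδε
  · rw [h1G]
    intro p q
    rw [scalarHom_mul_apply]
    exact hcB (j, p, q)
  · refine (norm_le_of_forall_entry fun p q => ?_).trans_lt hδε
    rw [CStarMatrix.sub_apply, scalarHom_mul_apply, mul_scalarHom_apply]
    exact (hcomm (j, p, q)).le

end MatrixSubalgebra

theorem proposition3p5 :
    -- tensor products
    (∀ (A₁ A₂ : Type*) [CStarAlgebra A₁] [CStarAlgebra A₂]
      (B₁ : StarSubalgebra ℂ A₁) (B₂ : StarSubalgebra ℂ A₂),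
      IsCentrallyLarge B₁ → IsCentrallyLarge B₂ →
      -- arbitrary faithful representations, which realize the minimal tensor product
      ∀ (H₁ H₂ : Type*)
        [NormedAddCommGroup H₁] [InnerProductSpace ℂ H₁] [CompleteSpace H₁]
        [NormedAddCommGroup H₂] [InnerProductSpace ℂ H₂] [CompleteSpace H₂]
        (π₁ : A₁ →⋆ₐ[ℂ] (H₁ →L[ℂ] H₁)) (π₂ : A₂ →⋆ₐ[ℂ] (H₂ →L[ℂ] H₂)),
        Function.Injective π₁ → Function.Injective π₂ →
        IsFiniteCStar (minTensor π₁ π₂) →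
        IsCentrallyLarge (minTensorSub π₁ π₂ B₁ B₂)) ∧
    -- matrix algebras
    (∀ (A : Type*) [CStarAlgebra A] (B : StarSubalgebra ℂ A),
      IsStablyFiniteCStar A → IsCentrallyLarge B → IsStablyCentrallyLarge B) :=
  ⟨fun _ _ _ _ _ _ hB₁ hB₂ _ _ _ _ _ _ _ _ _ _ hπ₁ hπ₂ hfin =>
    isCentrallyLarge_minTensorSub hB₁ hB₂ hπ₁ hπ₂ hfin,
    fun _ _ _ hfin hB _ hn => hB.matrixSubalgebra hfin hn⟩
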